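/- **Setting.** A database is a finite multiset $D=\{(x_i,y_i)\}_{i=1}^{n_1}$ of records in $\mathbb R^2$ (of any size $n_1\ge 0$). Two databases are neighbors if they are equal or differ in one record (one record is replaced, removed or added). A randomized algorithm $M$ is $(\epsilon',\delta')$-differentially private if $\Pr[M(D)\in S]\le e^{\epsilon'}\Pr[M(\hat D)\in S]+\delta'$ for all neighbors $D,\hat D$ and all measurable sets $S$ of outputs. $\mathrm{Lap}(b)$ is the Laplace distribution with density $\frac1{2b}e^{-|x|/b}$ ($\mathrm{Lap}(0)$ is the point mass at $0$). For a database $W$, $p(\theta\mid W)$ is the Bayesian posterior of $\theta$ in the model $y=\theta x+\xi$, $\xi\sim\mathcal N(0,\beta^{-1})$ independent for the records, with prior $\theta\sim\mathcal N(0,\alpha^{-1})$. **Parameters.** $0<\epsilon\le 1$, $0<\delta<\frac12$, $0<x_l<x_h$, $\alpha>0$, $\beta\ge 3/x_h^2$, $\rho_1\in(1,\frac32)$, $\rho_2\in(0,\frac12)$, $\gamma_1\in(\rho_2,\frac12)$. **Algorithm (Propose-Test-Sample)** on input $D=\{(x_i,y_i)\}_{i=1}^{n_1}$, with independent Laplace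 noises: 1. Replace every $x_i$ by $\min\{\max\{x_i,x_l\},x_h\}$ and every $y_i$ by $\max\{y_i,0\}$. 2. $\breve n_1\leftarrow n_1-\frac1\epsilon\log\frac1{2\delta}+\mathrm{Lap}(\frac1\epsilon)$, and $t\leftarrow\max\{\breve n_1,0\}^{\rho_1}$. 3. $V\leftarrow\{(x_i,y_i):\frac{y_i}{x_i}\le t\}$. 4. $n_2\leftarrow|V|-\frac1\epsilon\log\frac1{2\delta}+\mathrm{Lap}(\frac1\epsilon)$. If $n_2\le1$, return null. 5. $m\leftarrow\sum_Vx_iy_i/\sum_Vx_i^2$ (read as $0$ if $V=\emptyset$), and $\breve m\leftarrow m+\mathrm{Lap}\Bigl(\frac1\epsilon\,t\,\frac{2(n_2-1)x_h^2x_l^2+x_h^4}{n_2(n_2-1)x_l^4}\Bigr)$. 6. $W\leftarrow\{(x_i,y_i):|\frac{y_i}{x_i}-\breve m|\le n_2^{\rho_2}\}$ (among all clipped records). 7. $n_W\leftarrow|W|-\frac1\epsilon\log\frac1{2\delta}+\mathrm{Lap}(\frac1\epsilon)$. If $n_W<n_{\min}$, return null. 8. Return one sample from $p(\theta\mid W)$.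 Here $n_{\min}=\max\{n_{b1},n_{b2},n_1^{\rho_2/\gamma_1}\}$ where, with $\nu=\frac{2\ln(1/\delta)}\epsilon+1$, $K_1=\frac{(x_h^2\beta)(x_h^2\alpha+x_h^4\beta)}{\frac9{10}(x_l^2\beta)^2}$, $K_2=\frac{(x_h^2\alpha+x_h^4\beta)^2}{\frac9{10}x_l^6\beta}$ and $\breve m^+=\max\{\breve m,0\}$, $$n_{b1}=\max\Bigl\{1+\tfrac{x_h^2}{x_l^2}\tfrac8\epsilon,\ 1+\nu\tfrac{x_h^2}{x_l^2}\bigl(1+8\tfrac{\nu-1}\epsilon\bigr),\ \Bigl(\tfrac{16\nu\beta x_h^4}{\frac9{10}\epsilon x_l^2}\Bigr)^{\frac1{1-2\gamma_1}},\ \bigl(\tfrac{32\nu\beta}\epsilon K_1\breve m^+\bigr)^{\frac1{2-\gamma_1}},\ \bigl(\tfrac{32\nu\beta}\epsilon K_1\bigr)^{\frac1{2-2\gamma_1}},\ \bigl(\tfrac{8\nu}\epsilon K_2\breve m^+\bigr)^{\frac23},\ \bigl(\tfrac{8\nu}\epsilon K_2\bigr)^{\frac1{3-2\gamma_1}}\Bigr\},$$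 $$n_{b2}=\max\Bigl\{1+\tfrac{x_h^2}{x_l^2}\tfrac{10\nu}\beta,\ 1+\nu\tfrac{x_h^2}{x_l^2}\Bigr\}.$$ **Claim.** For all such parameters, the Propose-Test-Sample algorithm is $(5\epsilon,2\delta)$-differentially private. -/

import Mathlib

open MeasureTheory ProbabilityTheory

noncomputable section

/-- A record `(x, y)`, with covariate `x` and response `y`. -/
abbrev Record := ℝ × ℝ

/-- A database: a finite collection of records, with repetitions. -/
abbrev Database := Multiset Record

/-- Databases at distance at most one: equal, or one record is replaced, removed or added. -/
def Neighbors (D D' : Database) : Prop :=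
  (∃ (C : Database) (r r' : Record), D = r ::ₘ C ∧ D' = r' ::ₘ C) ∨
    (∃ r : Record, D = r ::ₘ D') ∨ (∃ r : Record, D' = r ::ₘ D) ∨ D = D'

/-- `(ε, δ)`-differential privacy of a randomized algorithm, given by its output law `M D` on every
input `D`, with respect to the neighboring relation `adj`. -/
structure IsDifferentiallyPrivate {𝓓 R : Type*} [MeasurableSpace R] (adj : 𝓓 → 𝓓 → Prop)
    (M : 𝓓 → Measure R) (ε δ : ℝ) : Prop where
  isProbabilityMeasure : ∀ D, IsProbabilityMeasure (M D)
  bound : ∀ D D', adj D D' → ∀ S, MeasurableSet S →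
    M D S ≤ ENNReal.ofReal (Real.exp ε) * M D' S + ENNReal.ofReal δ

/-- The centered Laplace distribution `Lap(b)`, of density `exp (-|x| / b) / (2 b)`; at scale zero
it is the point mass at `0`. -/
def laplace (b : ℝ) : Measure ℝ :=
  if b = 0 then Measure.dirac 0
  else volume.withDensity fun x => ENNReal.ofReal ((2 * b)⁻¹ * Real.exp (-|x| / b))

/-- The likelihood `∏ p(y | x, θ)` of a database in the linear model `y = θ x + ξ`, with noise
`ξ ∼ 𝓝(0, β⁻¹)`. -/
def likelihood (β : ℝ) (W : Database) (θ : ℝ) : ENNReal :=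
  (W.map fun r => gaussianPDF (θ * r.1) (β⁻¹).toNNReal r.2).prod

/-- The prior `𝓝(0, α⁻¹)` of `θ`. -/
def prior (α : ℝ) : Measure ℝ := gaussianReal 0 (α⁻¹).toNNReal

/-- The posterior `p(θ | W)` by Bayes' rule: the prior weighted by the likelihood, normalized. -/
def posteriorGiven (α β : ℝ) (W : Database) : Measure ℝ :=
  (∫⁻ θ, likelihood β W θ ∂prior α)⁻¹ • (prior α).withDensity (likelihood β W)

/-- The parameters of the Propose-Test-Sample algorithm. -/
structure PTSParams where
  (ε δ xl xh α β ρ₁ ρ₂ γ₁ : ℝ)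

namespace PTSParams

variable (P : PTSParams)

/-- Clipping of a record: `x` to `[xl, xh]` and `y` to `[0, ∞)`. -/
def clip (r : Record) : Record := (min (max r.1 P.xl) P.xh, max r.2 0)

/-- The shift `(1/ε) log (1/(2δ))` of the noisy counts. -/
def shift : ℝ := 1 / P.ε * Real.log (1 / (2 * P.δ))

/-- The bound `n̆₁ ^ ρ₁` on the slopes; a negative estimate `n̆₁` of the count is read as `0`. -/
def slopeBound (n₁' : ℝ) : ℝ := (max n₁' 0) ^ P.ρ₁

/-- The records of slope at most `n̆₁ ^ ρ₁`. -/
def V (D : Database) (n₁' : ℝ) : Database := D.filter fun r => r.2 / r.1 ≤ P.slopeBound n₁'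

/-- The least-squares slope `∑ x y / ∑ x²`. -/
def slope (V : Database) : ℝ :=
  (V.map fun r => r.1 * r.2).sum / (V.map fun r => r.1 ^ 2).sum

/-- The scale of the Laplace noise that is added to the slope. -/
def slopeScale (n₁' n₂ : ℝ) : ℝ :=
  1 / P.ε * P.slopeBound n₁' *
    ((2 * (n₂ - 1) * P.xh ^ 2 * P.xl ^ 2 + P.xh ^ 4) / (n₂ * (n₂ - 1) * P.xl ^ 4))

/-- The records that remain after the removal of outliers: `|y / x - m̆| ≤ n₂ ^ ρ₂`. -/
def W (D : Database) (n₂ m' : ℝ) : Database := D.filter fun r => |r.2 / r.1 - m'| ≤ n₂ ^ P.ρ₂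

/-- `ν = 2 ln (1/δ) / ε + 1`. -/
def ν : ℝ := 2 * Real.log (1 / P.δ) / P.ε + 1

/-- `(xh² β) (xh² α + xh⁴ β) / (9/10 (xl² β)²)`. -/
def K₁ : ℝ :=
  (P.xh ^ 2 * P.β) * (P.xh ^ 2 * P.α + P.xh ^ 4 * P.β) / (9 / 10 * (P.xl ^ 2 * P.β) ^ 2)

/-- `(xh² α + xh⁴ β)² / (9/10 xl⁶ β)`. -/
def K₂ : ℝ := (P.xh ^ 2 * P.α + P.xh ^ 4 * P.β) ^ 2 / (9 / 10 * P.xl ^ 6 * P.β)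

/-- The bound `n_{b1}`, as a function of `m̆`; a negative `m̆` is read as `0` in the two fractional
powers where it occurs. -/
def nb₁ (m' : ℝ) : ℝ :=
  max (1 + P.xh ^ 2 / P.xl ^ 2 * (8 / P.ε)) <|
  max (1 + P.ν * (P.xh ^ 2 / P.xl ^ 2) * (1 + 8 * ((P.ν - 1) / P.ε))) <|
  max ((16 * P.ν * P.β * P.xh ^ 4 / (9 / 10 * P.ε * P.xl ^ 2)) ^ (1 / (1 - 2 * P.γ₁))) <|
  max ((32 * P.ν * P.β / P.ε * P.K₁ * max m' 0) ^ (1 / (2 - P.γ₁))) <|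
  max ((32 * P.ν * P.β / P.ε * P.K₁) ^ (1 / (2 - 2 * P.γ₁))) <|
  max ((8 * P.ν / P.ε * P.K₂ * max m' 0) ^ (2 / 3 : ℝ))
    ((8 * P.ν / P.ε * P.K₂) ^ (1 / (3 - 2 * P.γ₁)))

/-- The bound `n_{b2}`. -/
def nb₂ : ℝ :=
  max (1 + P.xh ^ 2 / P.xl ^ 2 * (10 * P.ν / P.β)) (1 + P.ν * (P.xh ^ 2 / P.xl ^ 2))

/-- The threshold `n_min = max {n_{b1}, n_{b2}, n₁ ^ (ρ₂ / γ₁)}`. -/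
def nMin (n₁ m' : ℝ) : ℝ := max (P.nb₁ m') (max P.nb₂ (n₁ ^ (P.ρ₂ / P.γ₁)))

/-- The law of the output of the last steps, given `n₂` and `m̆`, on the clipped database `D`:
removal of outliers, the noisy test of the size, and one sample from the posterior.
The output `null` is `Sum.inl ()`. -/
def testSample (D : Database) (n₂ m' : ℝ) : Measure (Unit ⊕ ℝ) :=
  (laplace (1 / P.ε)).bind fun l =>
    let nW : ℝ := (P.W D n₂ m').card - P.shift + l
    if nW < P.nMin D.card m' then Measure.dirac (Sum.inl ())
    else (posteriorGiven P.α P.β (P.W D n₂ m')).map Sum.inr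

/-- The law of the output of the steps after the clipping, on the clipped database `D`. -/
def proposeTestSampleClipped (D : Database) : Measure (Unit ⊕ ℝ) :=
  (laplace (1 / P.ε)).bind fun l₁ =>
    let n₁' : ℝ := D.card - P.shift + l₁
    (laplace (1 / P.ε)).bind fun l₂ =>
      let n₂ : ℝ := (P.V D n₁').card - P.shift + l₂
      if n₂ ≤ 1 then Measure.dirac (Sum.inl ())
      else
        (laplace (P.slopeScale n₁' n₂)).bind fun l₃ =>
          let m' : ℝ := slope (P.V D n₁') + l₃
          P.testSample D n₂ m'

/-- The Propose-Test-Sample algorithm: the law of its output on the database `D`. -/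
def proposeTestSample (D : Database) : Measure (Unit ⊕ ℝ) :=
  P.proposeTestSampleClipped (D.map P.clip)

end PTSParams

end

/-! The budget `5ε` is spent in five equal parts: on the noisy sizes of `D` and of `V`, on the noisy
slope, on the size test and on the posterior sample. Each of the first four releases a real number
with Laplace noise, and between neighbors this number moves by at most `ε` times the noise scale.
Hence releasing it costs a factor `exp ε`, and it remains to compare the continuations at the same
released value (`lintegral_laplace_le`).

Two facts about `D` are needed that may fail. The first is `n₂ ≤ |V|`, on which both the sensitivity
of the slope and the bound `n₂ ^ ρ₂ ≤ |W| ^ γ₁` rest; the shift makes its failure have probability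
`δ`. The second is `|W| ≥ n_min`. If it is false, the test passes with probability at most `δ`, and
a failed test returns null for either database. If it is true, the posterior sample is `(ε,
δ)`-private. The last two errors belong to exclusive cases, so the total is `2δ`.

The size test releases `|W| - n_min`. Its threshold depends on the data through `n₁ ^ (ρ₂ / γ₁)`,
but the exponent is at most one, so one more record raises `|W|` and `n_min` each by an amount in
`[0, 1]`, and their difference has sensitivity one (`abs_testStatistic_sub_le`).

The posterior is Gaussian, of precision `L = α + β ∑ x²` and mean `β ∑ x y / L`. One record changes
`L` by at most `β xh²`, which is small against `β |W| xl²`. It changes the mean by at most `2 β xh²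
(R + α |m̆| / L) / L'`, where `R = n₂ ^ ρ₂` bounds the residuals. The threshold `n_min` makes both
changes small enough for the Rényi divergence of order `ν` to give `(ε, δ)`-closeness
(`gaussian_le_of_close`, `mean_term_le`, `posterior_le`). -/

/-! ### The Laplace distribution -/

theorem laplace_of_pos {b : ℝ} (hb : 0 < b) : laplace b =
    volume.withDensity fun x => ENNReal.ofReal ((2 * b)⁻¹ * Real.exp (-|x| / b)) :=
  if_neg hb.ne'

theorem measurable_laplaceDensity (b : ℝ) :
    Measurable fun x : ℝ => ENNReal.ofReal ((2 * b)⁻¹ * Real.exp (-|x| / b)) := by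
  fun_prop

theorem laplace_one_Ioi {s : ℝ} (hs : 0 ≤ s) :
    laplace 1 (Set.Ioi s) = ENNReal.ofReal (1 / 2 * Real.exp (-s)) := by
  rw [laplace_of_pos one_pos, withDensity_apply _ measurableSet_Ioi]
  have h : ∀ x ∈ Set.Ioi s, ENNReal.ofReal ((2 * 1)⁻¹ * Real.exp (-|x| / 1))
      = ENNReal.ofReal (1 / 2 * Real.exp (-x)) := by
    intro x hx
    rw [abs_of_pos (hs.trans_lt hx)]; norm_num
  rw [setLIntegral_congr_fun measurableSet_Ioi h, ← ofReal_integral_eq_lintegral_ofReal]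
  · rw [integral_const_mul, integral_exp_neg_Ioi]
  · exact (integrableOn_exp_neg_Ioi s).const_mul _
  · exact Filter.Eventually.of_forall fun x => by positivity

instance isProbabilityMeasure_laplace_one : IsProbabilityMeasure (laplace 1) := by
  refine ⟨?_⟩
  have h1 := laplace_one_Ioi le_rfl
  have h2 : laplace 1 (Set.Iio 0) = laplace 1 (Set.Ioi 0) := by
    rw [laplace_of_pos one_pos, withDensity_apply _ measurableSet_Ioi,
      withDensity_apply _ measurableSet_Iio]
    have := (Measure.measurePreserving_neg (volume : Measure ℝ)).setLIntegral_comp_preimage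
      (measurableSet_Iio (a := (0 : ℝ))) (measurable_laplaceDensity 1)
    rw [← this]
    simp
  have h3 : laplace 1 {0} = 0 := by
    rw [laplace_of_pos one_pos]
    exact withDensity_absolutelyContinuous _ _ (by simp)
  have hu : (Set.univ : Set ℝ) = Set.Iio 0 ∪ ({0} ∪ Set.Ioi 0) := by
    ext x; rcases lt_trichotomy x 0 with h | h | h <;> simp [h]
  rw [hu, measure_union _ (by measurability), measure_union _ measurableSet_Ioi, h2, h1, h3,
    zero_add, ← ENNReal.ofReal_add (by positivity) (by positivity)]
  · norm_num
  · simp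
  · rw [Set.disjoint_left]; intro x hx; rw [Set.mem_Iio] at hx; simp [hx]

/-- Used to pass from noise whose scale depends on earlier outputs to noise of a fixed law, which
gives measurability in the scale. -/
theorem laplace_eq_map {b : ℝ} (hb : 0 ≤ b) : laplace b = (laplace 1).map (b * ·) := by
  rcases hb.eq_or_lt with rfl | hb
  · simp only [zero_mul]
    rw [Measure.map_const, isProbabilityMeasure_laplace_one.measure_univ, one_smul, laplace,
      if_pos rfl]
  ext s hs
  rw [Measure.map_apply (by fun_prop) hs, laplace_of_pos hb, laplace_of_pos one_pos,
    withDensity_apply _ hs, withDensity_apply _ (measurable_const_mul b hs)]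
  conv_lhs => rw [← Real.smul_map_volume_mul_left hb.ne', Measure.restrict_smul, lintegral_smul_measure]
  rw [setLIntegral_map hs (measurable_laplaceDensity b) (by fun_prop), abs_of_pos hb, smul_eq_mul,
    ← lintegral_const_mul _ (by fun_prop)]
  refine lintegral_congr fun x => ?_
  rw [← ENNReal.ofReal_mul hb.le, abs_mul, abs_of_pos hb]
  congr 1
  field_simp

theorem isProbabilityMeasure_laplace {b : ℝ} (hb : 0 ≤ b) : IsProbabilityMeasure (laplace b) := by
  rw [laplace_eq_map hb]
  exact Measure.isProbabilityMeasure_map (by fun_prop)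

theorem laplace_Ici {b s : ℝ} (hb : 0 < b) (hs : 0 ≤ s) :
    laplace b (Set.Ici s) = ENNReal.ofReal (1 / 2 * Real.exp (-s / b)) := by
  have : laplace b (Set.Ici s) = laplace b (Set.Ioi s) := by
    rw [laplace_of_pos hb]
    exact measure_congr ((withDensity_absolutelyContinuous _ _).ae_eq Ioi_ae_eq_Ici).symm
  rw [this, laplace_eq_map hb.le, Measure.map_apply (by fun_prop) measurableSet_Ioi, neg_div,
    ← laplace_one_Ioi (by positivity)]
  congr 1
  ext x
  simp [div_lt_iff₀' hb]

/-- The Laplace mechanism: by the triangle inequality, the densities centered at `a` and `a'` have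
ratio at most `exp (|a - a'| / b)`. -/
theorem lintegral_laplace_shift_le {b : ℝ} (hb : 0 < b) {f : ℝ → ENNReal} (hf : Measurable f)
    {a a' c : ℝ} (h : |a - a'| ≤ c * b) :
    ∫⁻ l, f (a + l) ∂laplace b ≤ ENNReal.ofReal (Real.exp c) * ∫⁻ l, f (a' + l) ∂laplace b := by
  have key : ∀ t : ℝ, ∫⁻ l, f (t + l) ∂laplace b
      = ∫⁻ x, ENNReal.ofReal ((2 * b)⁻¹ * Real.exp (-|x - t| / b)) * f x := by
    intro t
    rw [laplace_of_pos hb,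
      lintegral_withDensity_eq_lintegral_mul _ (measurable_laplaceDensity b) (by fun_prop)]
    rw [← lintegral_add_left_eq_self (fun x => _ * f x) t]
    simp
  rw [key, key, ← lintegral_const_mul _ (by fun_prop)]
  refine lintegral_mono fun x => ?_
  rw [← mul_assoc, ← ENNReal.ofReal_mul (by positivity)]
  refine mul_le_mul_left (ENNReal.ofReal_le_ofReal ?_) _
  rw [mul_left_comm, ← Real.exp_add]
  gcongr
  rw [← sub_le_iff_le_add, ← sub_div, div_le_iff₀ hb]
  refine le_trans ?_ h
  have := abs_sub_abs_le_abs_sub (x - a') (x - a)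
  rw [show x - a' - (x - a) = a - a' by ring] at this
  linarith

/-! ### Closeness of Gaussian laws -/

theorem gaussianPDFReal_inv {L : ℝ} (hL : 0 < L) (μ θ : ℝ) :
    gaussianPDFReal μ (L⁻¹).toNNReal θ
      = Real.exp (1 / 2 * Real.log (L / (2 * Real.pi)) - L / 2 * (θ - μ) ^ 2) := by
  have hp := Real.pi_pos
  rw [gaussianPDFReal, Real.coe_toNNReal _ (by positivity), sub_eq_add_neg (1 / 2 * _), Real.exp_add,
    mul_comm (1 / 2 : ℝ), Real.exp_mul, Real.exp_log (by positivity), ← Real.sqrt_eq_rpow,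
    ← Real.sqrt_inv]
  congr 2
  · field_simp
  · field_simp

/-- Two Gaussian laws of precisions `L`, `L'` are `(ε, δ)`-close if their Rényi divergence of order
`k + 1` is at most `ε - log (1 / δ) / k`. -/
theorem gaussian_le_of_renyi {L L' μ μ' k ε δ : ℝ} (hL : 0 < L) (hL' : 0 < L') (hk : 0 ≤ k)
    (hδ : 0 < δ) (hpos : 0 < (k + 1) * L - k * L')
    (h : 1 / 2 * ((k + 1) * Real.log L - k * Real.log L' - Real.log ((k + 1) * L - k * L'))
      + (k + 1) * k * L * L' * (μ - μ') ^ 2 / (2 * ((k + 1) * L - k * L')) - k * ε ≤ Real.log δ)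
    (S : Set ℝ) :
    gaussianReal μ (L⁻¹).toNNReal S
      ≤ ENNReal.ofReal (Real.exp ε) * gaussianReal μ' (L'⁻¹).toNNReal S + ENNReal.ofReal δ := by
  have hp := Real.pi_pos
  set M := (k + 1) * L - k * L' with hM
  -- With `p`, `q` the two densities, `p ^ (k + 1) / q ^ k` is a multiple of the Gaussian density of
  -- precision `M` and mean `m`. The multiple is governed by the Rényi divergence.
  obtain ⟨m, hm⟩ : ∃ m, m = ((k + 1) * L * μ - k * L' * μ') / M := ⟨_, rfl⟩
  have hv : ∀ {A : ℝ}, 0 < A → (A⁻¹).toNNReal ≠ 0 := fun {A} hA => by simpa using hA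
  have hpt : ∀ θ, gaussianPDF μ (L⁻¹).toNNReal θ ≤
      ENNReal.ofReal (Real.exp ε) * gaussianPDF μ' (L'⁻¹).toNNReal θ
        + ENNReal.ofReal δ * gaussianPDF m (M⁻¹).toNNReal θ := by
    intro θ
    simp only [gaussianPDF, gaussianPDFReal_inv hL, gaussianPDFReal_inv hL',
      gaussianPDFReal_inv hpos]
    rw [← ENNReal.ofReal_mul (by positivity), ← ENNReal.ofReal_mul hδ.le,
      ← ENNReal.ofReal_add (by positivity) (by positivity)]
    refine ENNReal.ofReal_le_ofReal ?_
    rw [← Real.exp_add]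
    conv_rhs => rw [← Real.exp_log hδ]
    rw [← Real.exp_add]
    set A := 1 / 2 * Real.log (L / (2 * Real.pi)) - L / 2 * (θ - μ) ^ 2 with hA
    set B := 1 / 2 * Real.log (L' / (2 * Real.pi)) - L' / 2 * (θ - μ') ^ 2 with hB
    -- Where `p ≤ exp ε * q` the first summand suffices. Elsewhere `p` is at most `p * (p / (exp ε *
    -- q)) ^ k`, which is at most `δ` times the third Gaussian density.
    rcases le_total A (ε + B) with hAB | hAB
    · exact (Real.exp_le_exp.2 hAB).trans (le_add_of_nonneg_right (Real.exp_nonneg _))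
    · refine le_trans (Real.exp_le_exp.2 ?_) (le_add_of_nonneg_left (Real.exp_nonneg _))
      have h1 : A ≤ A + k * (A - B - ε) := by
        have := mul_nonneg hk (sub_nonneg.2 hAB)
        linarith
      refine h1.trans ?_
      have h2 : (k + 1) * L * (θ - μ) ^ 2 - k * L' * (θ - μ') ^ 2
          = M * (θ - m) ^ 2 - (k + 1) * k * L * L' * (μ - μ') ^ 2 / M := by
        rw [hm]
        field_simp
        rw [hM]
        ring
      have h3 : (k + 1) * k * L * L' * (μ - μ') ^ 2 / (2 * M)
          = (k + 1) * k * L * L' * (μ - μ') ^ 2 / M / 2 := by field_simp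
      rw [h3] at h
      rw [Real.log_div hL.ne' (by positivity)] at hA
      rw [Real.log_div hL'.ne' (by positivity)] at hB
      rw [Real.log_div hpos.ne' (by positivity), hA, hB]
      linear_combination h - 1 / 2 * h2
  rw [gaussianReal_of_var_ne_zero _ (hv hL), gaussianReal_of_var_ne_zero _ (hv hL')]
  calc volume.withDensity (gaussianPDF μ (L⁻¹).toNNReal) S
      ≤ volume.withDensity (ENNReal.ofReal (Real.exp ε) • gaussianPDF μ' (L'⁻¹).toNNReal
        + ENNReal.ofReal δ • gaussianPDF m (M⁻¹).toNNReal) S :=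
        withDensity_mono (Filter.Eventually.of_forall hpt) S
    _ = ENNReal.ofReal (Real.exp ε) * volume.withDensity (gaussianPDF μ' (L'⁻¹).toNNReal) S
        + ENNReal.ofReal δ * gaussianReal m (M⁻¹).toNNReal S := by
        rw [withDensity_add_left ((measurable_gaussianPDF _ _).const_smul _),
          withDensity_smul _ (measurable_gaussianPDF _ _),
          withDensity_smul _ (measurable_gaussianPDF _ _),
          gaussianReal_of_var_ne_zero _ (hv hpos)]
        simp
    _ ≤ _ := by
        gcongr
        exact mul_le_of_le_one_right' prob_le_one

/-- The choice of `k` gives `log δ = -k ε / 2`, so the two terms of the Rényi condition, from the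
precisions and from the means, may together use `k ε / 2`. -/
theorem gaussian_le_of_close {L L' μ μ' k ε δ : ℝ} (hL : 0 < L) (hL' : 0 < L') (hk : 0 < k)
    (hε : 0 < ε) (hε₁ : ε ≤ 1) (hδ : 0 < δ) (hkδ : k * ε / 2 = Real.log (1 / δ))
    (h1 : |L' - L| ≤ ε / 8 * L) (h2 : (k + 1) * |L' - L| ≤ L / 12)
    (h3 : (k + 1) * (L' * (μ - μ') ^ 2) ≤ 9 / 10 * ε) (S : Set ℝ) :
    gaussianReal μ (L⁻¹).toNNReal S
      ≤ ENNReal.ofReal (Real.exp ε) * gaussianReal μ' (L'⁻¹).toNNReal S + ENNReal.ofReal δ := by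
  obtain ⟨h, rfl⟩ : ∃ h, L' = L * (1 + h) := ⟨L' / L - 1, by field_simp; ring⟩
  have e1 : L * (1 + h) - L = L * h := by ring
  rw [e1, abs_mul, abs_of_pos hL] at h1 h2
  have a1 : |h| ≤ ε / 8 := by nlinarith
  have a2 : (k + 1) * |h| ≤ 1 / 12 := by nlinarith
  have hh : -(1 / 8) ≤ h := by have := neg_abs_le h; linarith
  have hkh : k * h ≤ 1 / 12 := by nlinarith [le_abs_self h, abs_nonneg h]
  have e2 : (k + 1) * L - k * (L * (1 + h)) = L * (1 - k * h) := by ring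
  have p1 : 0 < 1 + h := by linarith
  have p2 : 0 < 1 - k * h := by linarith
  refine gaussian_le_of_renyi hL hL' hk.le hδ (by rw [e2]; positivity) ?_ S
  rw [e2, Real.log_mul hL.ne' p1.ne', Real.log_mul hL.ne' p2.ne']
  have l1 : 1 - (1 + h)⁻¹ ≤ Real.log (1 + h) := Real.one_sub_inv_le_log_of_pos p1
  have l2 : 1 - (1 - k * h)⁻¹ ≤ Real.log (1 - k * h) := Real.one_sub_inv_le_log_of_pos p2
  -- The left side is `k (k + 1) h² / ((1 + h) (1 - k h))`. Here `(k + 1) h² ≤ ε / 96` and the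
  -- denominator is at least `7/8 * 11/12 = 77/96`.
  have l3 : -k * (1 - (1 + h)⁻¹) - (1 - (1 - k * h)⁻¹) ≤ k * (ε / 77) := by
    have : -k * (1 - (1 + h)⁻¹) - (1 - (1 - k * h)⁻¹)
        = k * ((k + 1) * h ^ 2) / ((1 + h) * (1 - k * h)) := by
      field_simp
      ring
    rw [this, div_le_iff₀ (by positivity), mul_assoc]
    refine mul_le_mul_of_nonneg_left ?_ hk.le
    have b1 : (k + 1) * h ^ 2 ≤ 1 / 12 * (ε / 8) := by
      rw [← sq_abs, sq, ← mul_assoc]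
      exact mul_le_mul a2 a1 (abs_nonneg _) (by norm_num)
    have b2 : 7 / 8 * (11 / 12) ≤ (1 + h) * (1 - k * h) :=
      mul_le_mul (by linarith) (by linarith) (by norm_num) p1.le
    have := mul_le_mul_of_nonneg_left b2 (show 0 ≤ ε / 77 by positivity)
    linarith
  -- The constant is `27/55 = (9/10) / (2 * 11/12)`. With half of `l3` the total is `1/154 + 27/55 <
  -- 1/2`.
  have l4 : (k + 1) * k * L * (L * (1 + h)) * (μ - μ') ^ 2 / (2 * (L * (1 - k * h)))
      ≤ k * (27 / 55 * ε) := by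
    have : (k + 1) * k * L * (L * (1 + h)) * (μ - μ') ^ 2 / (2 * (L * (1 - k * h)))
        = k * (((k + 1) * (L * (1 + h) * (μ - μ') ^ 2)) / (2 * (1 - k * h))) := by
      field_simp
    rw [this]
    refine mul_le_mul_of_nonneg_left ?_ hk.le
    rw [div_le_iff₀ (by positivity)]
    have := mul_le_mul_of_nonneg_left (show 11 / 12 ≤ 1 - k * h by linarith)
      (show 0 ≤ 27 / 55 * ε by positivity)
    linarith
  have l5 : Real.log δ = -(k * ε / 2) := by rw [hkδ, one_div, Real.log_inv]; ring
  have l6 := mul_le_mul_of_nonneg_left l1 hk.le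
  have hke : 0 < k * ε := by positivity
  rw [l5]
  linarith

/-! ### The Gaussian posterior -/

/-- The precision `α + β ∑ x²` of the posterior. -/
noncomputable def postPrecision (α β : ℝ) (W : Database) : ℝ :=
  α + β * (W.map fun r => r.1 ^ 2).sum

/-- The mean `β ∑ x y / (α + β ∑ x²)` of the posterior. -/
noncomputable def postMean (α β : ℝ) (W : Database) : ℝ :=
  β * (W.map fun r => r.1 * r.2).sum / postPrecision α β W

theorem sum_sq_nonneg (W : Database) : 0 ≤ (W.map fun r => r.1 ^ 2).sum := by
  refine Multiset.sum_nonneg fun x hx => ?_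
  obtain ⟨r, -, rfl⟩ := Multiset.mem_map.1 hx
  positivity

theorem postPrecision_pos {α β : ℝ} (hα : 0 < α) (hβ : 0 < β) (W : Database) :
    0 < postPrecision α β W := by
  have := sum_sq_nonneg W
  unfold postPrecision
  positivity

theorem measurable_likelihood (β : ℝ) (W : Database) : Measurable (likelihood β W) := by
  induction W using Multiset.induction_on with
  | empty =>
    have : likelihood β 0 = fun _ => 1 := by ext θ; simp [likelihood]
    rw [this]
    exact measurable_const
  | cons r W ih =>
    have : likelihood β (r ::ₘ W)
        = fun θ => gaussianPDF (θ * r.1) (β⁻¹).toNNReal r.2 * likelihood β W θ := by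
      ext θ; simp [likelihood]
    rw [this]
    refine Measurable.mul ?_ ih
    unfold gaussianPDF gaussianPDFReal
    fun_prop

/-- Each record adds a quadratic polynomial in `θ` to the exponent. The constant term `C` is left
unspecified since normalization removes it. -/
theorem prior_mul_likelihood {α β : ℝ} (hα : 0 < α) (hβ : 0 < β) (W : Database) :
    ∃ C : ℝ, ∀ θ, gaussianPDF 0 (α⁻¹).toNNReal θ * likelihood β W θ
      = ENNReal.ofReal (Real.exp (C - postPrecision α β W / 2 * θ ^ 2
        + β * (W.map fun r => r.1 * r.2).sum * θ)) := by
  induction W using Multiset.induction_on with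
  | empty =>
    refine ⟨1 / 2 * Real.log (α / (2 * Real.pi)), fun θ => ?_⟩
    simp [likelihood, gaussianPDF, gaussianPDFReal_inv hα, postPrecision]
  | cons r W ih =>
    obtain ⟨C, hC⟩ := ih
    refine ⟨C + (1 / 2 * Real.log (β / (2 * Real.pi)) - β / 2 * r.2 ^ 2), fun θ => ?_⟩
    have : likelihood β (r ::ₘ W) θ
        = gaussianPDF (θ * r.1) (β⁻¹).toNNReal r.2 * likelihood β W θ := by
      simp [likelihood]
    rw [this, mul_left_comm, hC, gaussianPDF, gaussianPDFReal_inv hβ,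
      ← ENNReal.ofReal_mul (by positivity), ← Real.exp_add]
    simp only [postPrecision, Multiset.map_cons, Multiset.sum_cons]
    congr 2
    ring

/-- Completing the square shows that the unnormalized posterior is a multiple of a Gaussian law. The
total mass of the latter is one, so the multiple is the evidence and cancels. -/
theorem posteriorGiven_eq_gaussianReal {α β : ℝ} (hα : 0 < α) (hβ : 0 < β) (W : Database) :
    posteriorGiven α β W
      = gaussianReal (postMean α β W) ((postPrecision α β W)⁻¹).toNNReal := by
  have hL := postPrecision_pos hα hβ W
  obtain ⟨C, hC⟩ := prior_mul_likelihood hα hβ W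
  have hv : ∀ {A : ℝ}, 0 < A → (A⁻¹).toNNReal ≠ 0 := fun {A} hA => by simpa using hA
  obtain ⟨c, hc, h⟩ : ∃ c : ℝ, 0 < c ∧ (prior α).withDensity (likelihood β W) = ENNReal.ofReal c •
      gaussianReal (postMean α β W) ((postPrecision α β W)⁻¹).toNNReal := by
    refine ⟨Real.exp (C + postPrecision α β W / 2 * postMean α β W ^ 2
      - 1 / 2 * Real.log (postPrecision α β W / (2 * Real.pi))), Real.exp_pos _, ?_⟩
    rw [prior, gaussianReal_of_var_ne_zero _ (hv hα), gaussianReal_of_var_ne_zero _ (hv hL),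
      ← withDensity_mul _ (measurable_gaussianPDF _ _) (measurable_likelihood β W),
      ← withDensity_smul _ (measurable_gaussianPDF _ _)]
    congr 1
    ext θ
    rw [Pi.mul_apply, hC, Pi.smul_apply, gaussianPDF, gaussianPDFReal_inv hL, smul_eq_mul,
      ← ENNReal.ofReal_mul (by positivity), ← Real.exp_add]
    congr 2
    rw [postMean]
    field_simp
    ring
  have hZ : ∫⁻ θ, likelihood β W θ ∂prior α = ENNReal.ofReal c := by
    rw [← setLIntegral_univ, ← withDensity_apply _ MeasurableSet.univ, h]
    simp
  rw [posteriorGiven, hZ, h, smul_smul, ENNReal.inv_mul_cancel (by simpa using hc) (by simp),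
    one_smul]

/-! ### Neighboring databases and the sensitivity of the posterior -/

/-- Databases that share all but at most one record of each. -/
def ShareAllButOne (D D' : Database) : Prop :=
  ∃ C A A' : Database, D = C + A ∧ D' = C + A' ∧ A.card ≤ 1 ∧ A'.card ≤ 1

theorem Neighbors.shareAllButOne {D D' : Database} (h : Neighbors D D') :
    ShareAllButOne D D' := by
  rcases h with ⟨C, r, r', rfl, rfl⟩ | ⟨r, rfl⟩ | ⟨r, rfl⟩ | rfl
  · exact ⟨C, {r}, {r'}, by rw [add_comm, Multiset.singleton_add],
      by rw [add_comm, Multiset.singleton_add], by rw [Multiset.card_singleton],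
      by rw [Multiset.card_singleton]⟩
  · exact ⟨D', {r}, 0, by rw [add_comm, Multiset.singleton_add], (add_zero _).symm,
      by rw [Multiset.card_singleton], zero_le_one⟩
  · exact ⟨D, 0, {r}, (add_zero _).symm, by rw [add_comm, Multiset.singleton_add], zero_le_one,
      by rw [Multiset.card_singleton]⟩
  · exact ⟨D, 0, 0, (add_zero _).symm, (add_zero _).symm, zero_le_one, zero_le_one⟩

namespace ShareAllButOne

variable {D D' : Database}

theorem map (h : ShareAllButOne D D') (f : Record → Record) :
    ShareAllButOne (D.map f) (D'.map f) := by
  obtain ⟨C, A, A', rfl, rfl, hA, hA'⟩ := h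
  exact ⟨C.map f, A.map f, A'.map f, by simp, by simp, by simpa, by simpa⟩

theorem filter (h : ShareAllButOne D D') (p : Record → Prop) [DecidablePred p] :
    ShareAllButOne (D.filter p) (D'.filter p) := by
  obtain ⟨C, A, A', rfl, rfl, hA, hA'⟩ := h
  exact ⟨C.filter p, A.filter p, A'.filter p, by simp, by simp,
    (Multiset.card_le_card (Multiset.filter_le _ _)).trans hA,
    (Multiset.card_le_card (Multiset.filter_le _ _)).trans hA'⟩

theorem abs_card_sub_le (h : ShareAllButOne D D') : |(D.card : ℝ) - D'.card| ≤ 1 := by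
  obtain ⟨C, A, A', rfl, rfl, hA, hA'⟩ := h
  have h1 : (A.card : ℝ) ≤ 1 := by exact_mod_cast hA
  have h2 : (A'.card : ℝ) ≤ 1 := by exact_mod_cast hA'
  have h3 : (0 : ℝ) ≤ A.card := by positivity
  have h4 : (0 : ℝ) ≤ A'.card := by positivity
  rw [Multiset.card_add, Multiset.card_add, abs_le]
  push_cast
  constructor <;> linarith

end ShareAllButOne

/-- The interval has to contain `0` because `A` may be empty. -/
theorem sum_map_mem_Icc {A : Database} (hA : A.card ≤ 1) {f : Record → ℝ} {lo hi : ℝ}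
    (hlo : lo ≤ 0) (hhi : 0 ≤ hi) (h : ∀ r ∈ A, lo ≤ f r ∧ f r ≤ hi) :
    lo ≤ (A.map f).sum ∧ (A.map f).sum ≤ hi := by
  rcases Nat.le_one_iff_eq_zero_or_eq_one.1 hA with h0 | h1
  · rw [Multiset.card_eq_zero.1 h0]
    simp [hlo, hhi]
  · obtain ⟨r, rfl⟩ := Multiset.card_eq_one.1 h1
    simpa using h r (by simp)

theorem card_mul_sq_le {W : Database} {xl : ℝ} (hxl : 0 ≤ xl) (h : ∀ r ∈ W, xl ≤ r.1) :
    W.card * xl ^ 2 ≤ (W.map fun r => r.1 ^ 2).sum := by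
  have := Multiset.sum_map_le_sum_map (fun _ : Record => xl ^ 2) (fun r : Record => r.1 ^ 2)
    (s := W) fun r hr => pow_le_pow_left₀ hxl (h r hr) 2
  simpa using this

theorem sum_mul_sub (W : Database) (c : ℝ) :
    (W.map fun r => r.1 * r.2 - c * r.1 ^ 2).sum
      = (W.map fun r => r.1 * r.2).sum - c * (W.map fun r => r.1 ^ 2).sum := by
  rw [Multiset.sum_map_sub, Multiset.sum_map_mul_left]

theorem scaled_mem_Icc {x y xh lo hi μ : ℝ} (hx : 0 < x) (hxh : x ≤ xh) (hlo : lo ≤ 0)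
    (hhi : 0 ≤ hi) (h1 : lo ≤ y / x - μ) (h2 : y / x - μ ≤ hi) :
    xh ^ 2 * lo ≤ x * y - μ * x ^ 2 ∧ x * y - μ * x ^ 2 ≤ xh ^ 2 * hi := by
  have e : x * y - μ * x ^ 2 = x ^ 2 * (y / x - μ) := by field_simp
  have hsq : x ^ 2 ≤ xh ^ 2 := pow_le_pow_left₀ hx.le hxh 2
  rw [e]
  constructor
  · exact (mul_le_mul_of_nonpos_right hsq hlo).trans (mul_le_mul_of_nonneg_left h1 (by positivity))
  · exact (mul_le_mul_of_nonneg_left h2 (by positivity)).trans (mul_le_mul_of_nonneg_right hsq hhi)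

theorem abs_postPrecision_sub_le {α β xh : ℝ} {W W' : Database} (h : ShareAllButOne W W')
    (hβ : 0 ≤ β) (hW : ∀ r ∈ W, 0 < r.1 ∧ r.1 ≤ xh) (hW' : ∀ r ∈ W', 0 < r.1 ∧ r.1 ≤ xh) :
    |postPrecision α β W' - postPrecision α β W| ≤ β * xh ^ 2 := by
  obtain ⟨C, A, A', rfl, rfl, hA, hA'⟩ := h
  have key : ∀ r : Record, 0 < r.1 ∧ r.1 ≤ xh → 0 ≤ r.1 ^ 2 ∧ r.1 ^ 2 ≤ xh ^ 2 :=
    fun r hr => ⟨by positivity, pow_le_pow_left₀ hr.1.le hr.2 2⟩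
  obtain ⟨h1, h2⟩ := sum_map_mem_Icc hA (f := fun r => r.1 ^ 2) le_rfl (sq_nonneg xh)
    fun r hr => key r (hW r (by simp [hr]))
  obtain ⟨h3, h4⟩ := sum_map_mem_Icc hA' (f := fun r => r.1 ^ 2) le_rfl (sq_nonneg xh)
    fun r hr => key r (hW' r (by simp [hr]))
  simp only [postPrecision, Multiset.map_add, Multiset.sum_add]
  rw [show ∀ a b c : ℝ, α + β * (a + b) - (α + β * (a + c)) = β * (b - c) by intros; ring,
    abs_mul, abs_of_nonneg hβ]
  refine mul_le_mul_of_nonneg_left ?_ hβ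
  rw [abs_le]
  constructor <;> linarith

/-- The posterior mean is the average of the slopes `y / x` with weights `β x²` and of the prior
mean `0` with weight `α`. The slopes are within `R` of `m`, and the prior pulls by at most `α |m| /
L`. -/
theorem abs_postMean_sub_le {α β m R : ℝ} {W : Database} (hα : 0 < α) (hβ : 0 < β) (hR : 0 ≤ R)
    (hW : ∀ r ∈ W, 0 < r.1) (hm : ∀ r ∈ W, |r.2 / r.1 - m| ≤ R) :
    |postMean α β W - m| ≤ R + α * |m| / postPrecision α β W := by
  have hL := postPrecision_pos hα hβ W
  have h1 : |(W.map fun r => r.1 * r.2 - m * r.1 ^ 2).sum|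
      ≤ R * (W.map fun r => r.1 ^ 2).sum := by
    rw [← Multiset.sum_map_mul_left, abs_le, ← Multiset.sum_map_neg', Multiset.map_map]
    simp only [Function.comp_def]
    have key : ∀ r ∈ W, -(R * r.1 ^ 2) ≤ r.1 * r.2 - m * r.1 ^ 2 ∧
        r.1 * r.2 - m * r.1 ^ 2 ≤ R * r.1 ^ 2 := by
      intro r hr
      have hx := hW r hr
      obtain ⟨h1, h2⟩ := abs_le.1 (hm r hr)
      have := scaled_mem_Icc hx le_rfl (neg_nonpos.2 hR) hR h1 h2
      constructor <;> linarith
    exact ⟨Multiset.sum_map_le_sum_map _ _ fun r hr => (key r hr).1,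
      Multiset.sum_map_le_sum_map _ _ fun r hr => (key r hr).2⟩
  have h2 : postMean α β W - m
      = (β * (W.map fun r => r.1 * r.2 - m * r.1 ^ 2).sum - α * m) / postPrecision α β W := by
    rw [sum_mul_sub, postMean, eq_div_iff hL.ne', sub_mul, div_mul_cancel₀ _ hL.ne']
    simp only [postPrecision]
    ring
  have h3 : |β * (W.map fun r => r.1 * r.2 - m * r.1 ^ 2).sum - α * m|
      ≤ β * (R * (W.map fun r => r.1 ^ 2).sum) + α * |m| := by
    refine (abs_sub _ _).trans ?_
    rw [abs_mul, abs_mul, abs_of_pos hα, abs_of_pos hβ]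
    gcongr
  rw [h2, abs_div, abs_of_pos hL, div_le_iff₀ hL, add_mul, div_mul_cancel₀ _ hL.ne']
  refine h3.trans ?_
  have : 0 ≤ R * α := by positivity
  simp only [postPrecision]
  linarith

/-- By the normal equation of `W`, the common records cancel from `L' (μ - μ')`, and only `x y - μ
x²` at the exceptional records remains. These values lie in one interval of length `2 xh² T` around
`0`, so even a replacement costs one such length. -/
theorem abs_postMean_sub_postMean_le {α β xh m R : ℝ} {W W' : Database}
    (h : ShareAllButOne W W') (hα : 0 < α) (hβ : 0 < β) (hR : 0 ≤ R)
    (hW : ∀ r ∈ W, 0 < r.1 ∧ r.1 ≤ xh) (hW' : ∀ r ∈ W', 0 < r.1 ∧ r.1 ≤ xh)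
    (hm : ∀ r ∈ W, |r.2 / r.1 - m| ≤ R) (hm' : ∀ r ∈ W', |r.2 / r.1 - m| ≤ R) :
    postPrecision α β W' * |postMean α β W - postMean α β W'|
      ≤ 2 * β * xh ^ 2 * (R + α * |m| / postPrecision α β W) := by
  have hL := postPrecision_pos hα hβ W
  have hL' := postPrecision_pos hα hβ W'
  have hv := abs_postMean_sub_le hα hβ hR (fun r hr => (hW r hr).1) hm
  set T := R + α * |m| / postPrecision α β W with hT
  set μ := postMean α β W with hμ
  have hRT : R ≤ T := le_add_of_nonneg_right (by positivity)
  obtain ⟨hv1, hv2⟩ := abs_le.1 hv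
  have key : ∀ r : Record, 0 < r.1 ∧ r.1 ≤ xh → |r.2 / r.1 - m| ≤ R →
      xh ^ 2 * (-T - (μ - m)) ≤ r.1 * r.2 - μ * r.1 ^ 2 ∧
        r.1 * r.2 - μ * r.1 ^ 2 ≤ xh ^ 2 * (T - (μ - m)) := by
    intro r hr hrm
    obtain ⟨h1, h2⟩ := abs_le.1 hrm
    exact scaled_mem_Icc hr.1 hr.2 (by linarith) (by linarith) (by linarith) (by linarith)
  obtain ⟨C, A, A', rfl, rfl, hA, hA'⟩ := h
  have n1 : xh ^ 2 * (-T - (μ - m)) ≤ 0 :=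
    mul_nonpos_of_nonneg_of_nonpos (sq_nonneg _) (by linarith)
  have n2 : 0 ≤ xh ^ 2 * (T - (μ - m)) := mul_nonneg (sq_nonneg _) (by linarith)
  obtain ⟨h1, h2⟩ := sum_map_mem_Icc hA n1 n2
    fun r hr => key r (hW r (by simp [hr])) (hm r (by simp [hr]))
  obtain ⟨h3, h4⟩ := sum_map_mem_Icc hA' n1 n2
    fun r hr => key r (hW' r (by simp [hr])) (hm' r (by simp [hr]))
  have e : postPrecision α β (C + A') * (μ - postMean α β (C + A'))
      = β * ((A.map fun r => r.1 * r.2 - μ * r.1 ^ 2).sum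
        - (A'.map fun r => r.1 * r.2 - μ * r.1 ^ 2).sum) := by
    have e1 : postPrecision α β (C + A') * postMean α β (C + A')
        = β * ((C + A').map fun r => r.1 * r.2).sum := by
      rw [postMean, mul_div_cancel₀ _ hL'.ne']
    have e2 : postPrecision α β (C + A) * μ = β * ((C + A).map fun r => r.1 * r.2).sum := by
      rw [hμ, postMean, mul_div_cancel₀ _ hL.ne']
    rw [mul_sub, e1, sum_mul_sub, sum_mul_sub]
    simp only [postPrecision, Multiset.map_add, Multiset.sum_add] at e2 ⊢
    linear_combination e2
  rw [← abs_of_pos hL', ← abs_mul, e, abs_mul, abs_of_pos hβ,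
    show 2 * β * xh ^ 2 * T = β * (2 * xh ^ 2 * T) by ring]
  refine mul_le_mul_of_nonneg_left ?_ hβ.le
  rw [abs_le]
  constructor <;> linarith

/-! ### The threshold `n_min` and privacy of the posterior sample -/

/-- The constraints on the parameters of the Propose-Test-Sample algorithm. -/
structure PTSParams.Admissible (P : PTSParams) : Prop where
  hε : 0 < P.ε
  hε₁ : P.ε ≤ 1
  hδ : 0 < P.δ
  hδ₁ : P.δ < 1 / 2
  hxl : 0 < P.xl
  hxh : P.xl < P.xh
  hα : 0 < P.α
  hβ : 3 / P.xh ^ 2 ≤ P.β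
  hρ₂ : 0 < P.ρ₂
  hγ₁ : P.ρ₂ < P.γ₁
  hγ₁' : P.γ₁ < 1 / 2

/-- A clipped record. -/
def PTSParams.IsClipped (P : PTSParams) (r : Record) : Prop :=
  P.xl ≤ r.1 ∧ r.1 ≤ P.xh ∧ 0 ≤ r.2

namespace PTSParams.Admissible

variable {P : PTSParams} (hP : P.Admissible)
include hP

theorem xh_pos : 0 < P.xh := hP.hxl.trans hP.hxh

theorem β_pos : 0 < P.β := lt_of_lt_of_le (by have := hP.xh_pos; positivity) hP.hβ

theorem log_inv_δ : 69 / 100 ≤ Real.log (1 / P.δ) := by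
  have h1 : (2 : ℝ) ≤ 1 / P.δ := by
    rw [le_div_iff₀ hP.hδ]
    linarith [hP.hδ₁]
  have := Real.log_le_log (by norm_num) h1
  linarith [Real.log_two_gt_d9]

theorem ν_sub_one : 138 / 100 ≤ P.ν - 1 := by
  have h := hP.log_inv_δ
  have := hP.hε
  rw [PTSParams.ν, add_sub_cancel_right, le_div_iff₀ hP.hε]
  nlinarith [hP.hε₁]

/-- This is where `β xh² ≥ 3` enters: `K₂` is at least `(xh⁴ β)² / (9/10 xl⁶ β)`. -/
theorem one_le_K₂ : 1 ≤ P.K₂ := by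
  have h1 := hP.xh_pos
  have h2 := hP.β_pos
  have h3 := hP.hxl
  have h4 := hP.hα
  have h5 : 3 ≤ P.β * P.xh ^ 2 := (div_le_iff₀ (by positivity)).1 hP.hβ
  rw [PTSParams.K₂, one_le_div (by positivity)]
  have h6 : P.xl ^ 6 ≤ P.xh ^ 6 := pow_le_pow_left₀ h3.le hP.hxh.le 6
  calc 9 / 10 * P.xl ^ 6 * P.β ≤ 3 * (P.xh ^ 6 * P.β) := by
        have := mul_le_mul_of_nonneg_right h6 h2.le
        have : 0 < P.xl ^ 6 * P.β := by positivity
        linarith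
    _ ≤ P.β * P.xh ^ 2 * (P.xh ^ 6 * P.β) := by gcongr
    _ = (P.xh ^ 4 * P.β) ^ 2 := by ring
    _ ≤ _ := by gcongr; exact le_add_of_nonneg_left (by positivity)

/-- The consequences of `n ≥ n_min` that the privacy of the posterior needs. -/
theorem of_nMin_le {n₁ m n : ℝ} (hn : P.nMin n₁ m ≤ n) :
    8 * P.xh ^ 2 ≤ P.ε * (n * P.xl ^ 2) ∧ 12 * P.ν * P.xh ^ 2 ≤ n * P.xl ^ 2 ∧ 29 ≤ n ∧
      16 * P.ν * P.β * P.xh ^ 4 * (n ^ P.γ₁) ^ 2 ≤ 9 / 10 * P.ε * P.xl ^ 2 * n ∧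
      (8 * P.ν * P.K₂ * max m 0) ^ 2 ≤ P.ε ^ 2 * n ^ 3 ∧ n₁ ^ (P.ρ₂ / P.γ₁) ≤ n := by
  have h1 := hP.xh_pos
  have h2 := hP.β_pos
  have h3 := hP.hxl
  have h4 := hP.hε
  have hν := hP.ν_sub_one
  have hK := hP.one_le_K₂
  have hν0 : 0 < P.ν := by linarith
  have hγ : 0 < P.γ₁ := hP.hρ₂.trans hP.hγ₁
  have hγ' := hP.hγ₁'
  simp only [PTSParams.nMin, PTSParams.nb₁, max_le_iff] at hn
  obtain ⟨⟨c1, c2, c3, -, -, c6, -⟩, -, c8⟩ := hn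
  have hq : 1 ≤ P.xh ^ 2 / P.xl ^ 2 := by
    rw [one_le_div (by positivity)]
    exact pow_le_pow_left₀ h3.le hP.hxh.le 2
  have hν' : 11 ≤ 8 * ((P.ν - 1) / P.ε) := by
    have : 138 / 100 ≤ (P.ν - 1) / P.ε := by
      rw [le_div_iff₀ h4]
      nlinarith [hP.hε₁]
    linarith
  have hνq : 2 ≤ P.ν * (P.xh ^ 2 / P.xl ^ 2) := by nlinarith
  -- The factor `12` is `1 + 11`, with `11 ≤ 8 (ν - 1) / ε` from `ν - 1 ≥ 1.38`.
  have d2 : 1 + 12 * (P.ν * (P.xh ^ 2 / P.xl ^ 2)) ≤ n := by nlinarith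
  have n0 : 0 < n := by linarith
  have e : P.xh ^ 2 = P.xh ^ 2 / P.xl ^ 2 * P.xl ^ 2 := by field_simp
  refine ⟨?_, ?_, ?_, ?_, ?_, c8⟩
  · have : P.xh ^ 2 / P.xl ^ 2 * (8 / P.ε) ≤ n := by linarith
    rw [div_mul_div_comm, div_le_iff₀ (by positivity)] at this
    linarith
  · have : 12 * (P.ν * (P.xh ^ 2 / P.xl ^ 2)) * P.xl ^ 2 ≤ n * P.xl ^ 2 := by gcongr; linarith
    calc _ = 12 * (P.ν * (P.xh ^ 2 / P.xl ^ 2)) * P.xl ^ 2 := by field_simp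
      _ ≤ _ := this
  · have : 238 / 100 ≤ P.ν * (P.xh ^ 2 / P.xl ^ 2) := by nlinarith
    have : P.ν * (P.xh ^ 2 / P.xl ^ 2) * 12 ≥ 28 := by linarith
    linarith
  · rw [one_div, Real.rpow_inv_le_iff_of_pos (by positivity) n0.le (by linarith),
      div_le_iff₀ (by positivity)] at c3
    have e1 : n ^ (1 - 2 * P.γ₁) * (n ^ P.γ₁) ^ 2 = n := by
      rw [← Real.rpow_natCast, ← Real.rpow_mul n0.le, ← Real.rpow_add n0]
      have : 1 - 2 * P.γ₁ + P.γ₁ * (2 : ℕ) = 1 := by push_cast; ring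
      rw [this, Real.rpow_one]
    calc _ ≤ n ^ (1 - 2 * P.γ₁) * (9 / 10 * P.ε * P.xl ^ 2) * (n ^ P.γ₁) ^ 2 := by gcongr
      _ = 9 / 10 * P.ε * P.xl ^ 2 * (n ^ (1 - 2 * P.γ₁) * (n ^ P.γ₁) ^ 2) := by ring
      _ = _ := by rw [e1]
  · have hm : 0 ≤ max m 0 := le_max_right _ _
    -- Squaring the inverse power `n ^ (3/2)` leads to the integer power `n ^ 3`.
    rw [show (2 / 3 : ℝ) = (3 / 2)⁻¹ by norm_num,
      Real.rpow_inv_le_iff_of_pos (by positivity) n0.le (by norm_num)] at c6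
    have e1 : (n ^ (3 / 2 : ℝ)) ^ 2 = n ^ 3 := by
      rw [← Real.rpow_natCast, ← Real.rpow_mul n0.le]
      norm_num
    have := pow_le_pow_left₀ (by positivity) c6 2
    rw [e1] at this
    calc _ = P.ε ^ 2 * (8 * P.ν / P.ε * P.K₂ * max m 0) ^ 2 := by field_simp
      _ ≤ _ := by gcongr

/-- By `(R + a)² ≤ 2 R² + 2 a²`, the left side splits into a residual part, at most `ε L' / 2`, and
a prior part with `a = α |m| / L`, at most `4/10 ε L'`. -/
theorem mean_term_le {n m R L L' : ℝ} (hR : 0 ≤ R) (hn : 29 ≤ n) (hm : -R ≤ m)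
    (h1 : 16 * P.ν * P.β * P.xh ^ 4 * R ^ 2 ≤ 9 / 10 * P.ε * P.xl ^ 2 * n)
    (h2 : (8 * P.ν * P.K₂ * max m 0) ^ 2 ≤ P.ε ^ 2 * n ^ 3)
    (hL : P.α + P.β * (n * P.xl ^ 2) ≤ L) (hL' : P.α + 9 / 10 * (P.β * (n * P.xl ^ 2)) ≤ L') :
    P.ν * (2 * P.β * P.xh ^ 2 * (R + P.α * |m| / L)) ^ 2 ≤ 9 / 10 * P.ε * L' := by
  have hx := hP.xh_pos
  have hβ := hP.β_pos
  have hxl := hP.hxl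
  have hε := hP.hε
  have hα := hP.hα
  have hν : 0 < P.ν := by linarith [hP.ν_sub_one]
  have hK := hP.one_le_K₂
  set B := P.β * (n * P.xl ^ 2) with hB
  have hB0 : 0 < B := by positivity
  have hL0 : 0 < L := by linarith
  have hL0' : 0 < L' := by linarith
  set X := 8 * P.ν * P.β ^ 2 * P.xh ^ 4 with hX
  have hX0 : 0 < X := by positivity
  set a := P.α * |m| / L with ha
  have hRX : X * R ^ 2 ≤ 1 / 2 * P.ε * (9 / 10 * B) := by
    have := mul_le_mul_of_nonneg_left h1 hβ.le
    rw [hX, hB]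
    linarith
  have hLL : (P.α + B) ^ 2 * (P.α + 9 / 10 * B) ≤ L ^ 2 * L' := by gcongr
  have haX : X * a ^ 2 ≤ 4 / 10 * P.ε * L' := by
    rw [ha, div_pow, ← mul_div_assoc, div_le_iff₀ (by positivity),
      mul_assoc (4 / 10 * P.ε), mul_comm L', mul_pow, sq_abs]
    refine le_trans ?_ (mul_le_mul_of_nonneg_left hLL (by positivity))
    -- If `m ≤ R`, then `|m| ≤ R` and the prior part reduces to the residual bound. Otherwise `m >
    -- 0` unless `m = R = 0`, and the `K₂` term of `n_min` controls it.
    rcases le_total m R with hmR | hmR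
    · have hm2 : m ^ 2 ≤ R ^ 2 := sq_le_sq' hm hmR
      calc X * (P.α ^ 2 * m ^ 2) ≤ P.α ^ 2 * (X * R ^ 2) := by
            rw [mul_left_comm]; gcongr
        _ ≤ P.α ^ 2 * (1 / 2 * P.ε * (9 / 10 * B)) := by gcongr
        _ = 4 / 10 * P.ε * (9 / 8 * (P.α ^ 2 * B)) := by ring
        _ ≤ 4 / 10 * P.ε * ((P.α + B) ^ 2 * (P.α + 9 / 10 * B)) := by
            refine mul_le_mul_of_nonneg_left ?_ (by positivity)
            have e1 : (P.α + B) ^ 2 * (P.α + 9 / 10 * B) = P.α ^ 3 + 29 / 10 * (P.α ^ 2 * B)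
              + 28 / 10 * (P.α * B ^ 2) + 9 / 10 * B ^ 3 := by ring
            have : 0 < P.α ^ 3 := by positivity
            have : 0 < P.α ^ 2 * B := by positivity
            have : 0 < P.α * B ^ 2 := by positivity
            have : 0 < B ^ 3 := by positivity
            linarith
    · have hm0 : 0 ≤ m := hR.trans hmR
      rw [max_eq_left hm0] at h2
      set Y := P.xh ^ 2 * P.α + P.xh ^ 4 * P.β with hY
      have hKY : P.K₂ * (9 / 10 * P.xl ^ 6 * P.β) = Y ^ 2 := by
        rw [PTSParams.K₂, div_mul_cancel₀ _ (by positivity)]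
      have hY2 : P.xh ^ 4 * P.α ^ 2 ≤ Y ^ 2 := by
        rw [show P.xh ^ 4 * P.α ^ 2 = (P.xh ^ 2 * P.α) ^ 2 by ring]
        gcongr
        exact le_add_of_nonneg_right (by positivity)
      have hνK : 1 ≤ P.ν * P.K₂ := by nlinarith [hP.ν_sub_one]
      have hB3 : 9 / 10 * B ^ 3 ≤ (P.α + B) ^ 2 * (P.α + 9 / 10 * B) := by
        calc 9 / 10 * B ^ 3 = B ^ 2 * (9 / 10 * B) := by ring
          _ ≤ _ := by gcongr <;> linarith
      have e2 : P.K₂ * (9 / 10 * B ^ 3) = P.β ^ 2 * n ^ 3 * Y ^ 2 := by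
        rw [← hKY, hB]; ring
      refine le_trans ?_ (mul_le_mul_of_nonneg_left hB3 (by positivity))
      have hc : 0 < 8 * P.ν * P.K₂ ^ 2 := by positivity
      -- The factor `8 ν K₂²` makes `(8 ν K₂ m)²` appear, to which `h2` applies. The spare factor `ν
      -- K₂ ≥ 1` absorbs the constants.
      refine le_of_mul_le_mul_left ?_ hc
      calc 8 * P.ν * P.K₂ ^ 2 * (X * (P.α ^ 2 * m ^ 2))
          = P.β ^ 2 * (P.xh ^ 4 * P.α ^ 2) * (8 * P.ν * P.K₂ * m) ^ 2 := by rw [hX]; ring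
        _ ≤ P.β ^ 2 * Y ^ 2 * (P.ε ^ 2 * n ^ 3) := by gcongr
        _ = P.ε * (P.ε * (P.β ^ 2 * n ^ 3 * Y ^ 2)) := by ring
        _ ≤ 1 * (P.ε * (P.β ^ 2 * n ^ 3 * Y ^ 2)) := by
            gcongr
            exact hP.hε₁
        _ ≤ (32 / 10 * (P.ν * P.K₂)) * (P.ε * (P.β ^ 2 * n ^ 3 * Y ^ 2)) := by
            gcongr
            linarith
        _ = 8 * P.ν * P.K₂ ^ 2 * (4 / 10 * P.ε * (9 / 10 * B ^ 3)) := by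
            rw [← e2]; ring
  have h4 : P.ν * (2 * P.β * P.xh ^ 2 * (R + a)) ^ 2 ≤ X * R ^ 2 + X * a ^ 2 := by
    have : P.ν * (2 * P.β * P.xh ^ 2 * (R + a)) ^ 2 = X * (R + a) ^ 2 / 2 := by rw [hX]; ring
    rw [this]
    nlinarith [mul_nonneg hX0.le (sq_nonneg (R - a))]
  have h5 : 1 / 2 * P.ε * (9 / 10 * B) ≤ 1 / 2 * P.ε * L' := by gcongr; linarith
  linarith

/-- Sampling from the posterior is private on databases of size at least `n_min`. -/
theorem posterior_le {W W' : Database} {n₁ m R : ℝ} (h : ShareAllButOne W W')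
    (hW : ∀ r ∈ W, P.IsClipped r) (hW' : ∀ r ∈ W', P.IsClipped r) (hn : P.nMin n₁ m ≤ W.card)
    (hR : 0 ≤ R) (hRn : R ≤ (W.card : ℝ) ^ P.γ₁)
    (hm : ∀ r ∈ W, |r.2 / r.1 - m| ≤ R) (hm' : ∀ r ∈ W', |r.2 / r.1 - m| ≤ R) (S : Set ℝ) :
    posteriorGiven P.α P.β W S
      ≤ ENNReal.ofReal (Real.exp P.ε) * posteriorGiven P.α P.β W' S + ENNReal.ofReal P.δ := by
  obtain ⟨c1, c2, c3, c4, c5, -⟩ := hP.of_nMin_le hn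
  have hβ := hP.β_pos
  have hx := hP.xh_pos
  have hν := hP.ν_sub_one
  have hxl := hP.hxl
  have hε := hP.hε
  have hL := postPrecision_pos hP.hα hβ W
  have hL' := postPrecision_pos hP.hα hβ W'
  have hWx : ∀ r ∈ W, 0 < r.1 ∧ r.1 ≤ P.xh :=
    fun r hr => ⟨hxl.trans_le (hW r hr).1, (hW r hr).2.1⟩
  have hWx' : ∀ r ∈ W', 0 < r.1 ∧ r.1 ≤ P.xh :=
    fun r hr => ⟨hxl.trans_le (hW' r hr).1, (hW' r hr).2.1⟩
  have hcard := (abs_le.1 h.abs_card_sub_le).2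
  set n : ℝ := (W.card : ℝ) with hn_def
  have hLn : P.α + P.β * (n * P.xl ^ 2) ≤ postPrecision P.α P.β W := by
    have := card_mul_sq_le hxl.le fun r hr => (hW r hr).1
    simp only [postPrecision]
    gcongr
  -- `W'` has at least `n - 1` records, and `n - 1 ≥ 9/10 n` since `n ≥ 29`.
  have hLn' : P.α + 9 / 10 * (P.β * (n * P.xl ^ 2)) ≤ postPrecision P.α P.β W' := by
    have h1 := card_mul_sq_le hxl.le fun r hr => (hW' r hr).1
    have h2 : 9 / 10 * (n * P.xl ^ 2) ≤ W'.card * P.xl ^ 2 := by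
      rw [← mul_assoc]
      gcongr
      linarith
    have := mul_le_mul_of_nonneg_left (h2.trans h1) hβ.le
    simp only [postPrecision]
    linarith
  -- A record of `W` has nonnegative slope because `y` was clipped at `0`, and this slope is within
  -- `R` of `m`.
  have hmR : -R ≤ m := by
    have h0 : 0 < W.card := by
      have : (0 : ℝ) < W.card := by linarith
      exact_mod_cast this
    obtain ⟨r, hr⟩ := Multiset.card_pos_iff_exists_mem.1 h0
    have h1 := (abs_le.1 (hm r hr)).2
    have h2 : 0 ≤ r.2 / r.1 := div_nonneg (hW r hr).2.2 (hWx r hr).1.le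
    linarith
  have hR2 : 16 * P.ν * P.β * P.xh ^ 4 * R ^ 2 ≤ 9 / 10 * P.ε * P.xl ^ 2 * n := by
    refine le_trans ?_ c4
    have : 0 < P.ν := by linarith
    gcongr
  have hmean := hP.mean_term_le hR c3 hmR hR2 c5 hLn hLn'
  have hdiff := abs_postMean_sub_postMean_le h hP.hα hβ hR hWx hWx' hm hm'
  have hprec := abs_postPrecision_sub_le (α := P.α) h hβ.le hWx hWx'
  rw [posteriorGiven_eq_gaussianReal hP.hα hβ, posteriorGiven_eq_gaussianReal hP.hα hβ]
  refine gaussian_le_of_close hL hL' (k := P.ν - 1) (by linarith) hε hP.hε₁ hP.hδ ?_ ?_ ?_ ?_ S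
  · rw [PTSParams.ν]
    field_simp
    ring
  · refine hprec.trans ?_
    have h1 := mul_le_mul_of_nonneg_left c1 hβ.le
    have h2 := mul_le_mul_of_nonneg_left hLn hε.le
    have h3 := mul_pos hε hP.hα
    linarith
  · rw [sub_add_cancel]
    refine (mul_le_mul_of_nonneg_left hprec (by linarith)).trans ?_
    have h1 := mul_le_mul_of_nonneg_left c2 hβ.le
    linarith [hP.hα]
  · rw [sub_add_cancel]
    have h1 := pow_le_pow_left₀ (by positivity) hdiff 2
    rw [mul_pow, sq_abs] at h1
    have h2 : P.ν * (postPrecision P.α P.β W' ^ 2 *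
        (postMean P.α P.β W - postMean P.α P.β W') ^ 2)
          ≤ 9 / 10 * P.ε * postPrecision P.α P.β W' :=
      (mul_le_mul_of_nonneg_left h1 (by linarith)).trans hmean
    refine le_of_mul_le_mul_right ?_ hL'
    linarith

omit hP in
theorem _root_.PTSParams.nMin_mono {P : PTSParams} (hp : 0 ≤ P.ρ₂ / P.γ₁) {a b : ℝ} (ha : 0 ≤ a)
    (hab : a ≤ b) (m : ℝ) : P.nMin a m ≤ P.nMin b m := by
  unfold PTSParams.nMin
  gcongr

theorem nMin_add_one_le {a : ℝ} (ha : 0 ≤ a) (m : ℝ) :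
    P.nMin (a + 1) m ≤ P.nMin a m + 1 := by
  have hγ : 0 < P.γ₁ := hP.hρ₂.trans hP.hγ₁
  have hp : 0 ≤ P.ρ₂ / P.γ₁ := div_nonneg hP.hρ₂.le hγ.le
  have hp1 : P.ρ₂ / P.γ₁ ≤ 1 := by rw [div_le_one hγ]; exact hP.hγ₁.le
  have h := Real.rpow_add_le_add_rpow ha zero_le_one hp hp1
  rw [Real.one_rpow] at h
  unfold PTSParams.nMin
  refine max_le ?_ (max_le ?_ ?_)
  · linarith [le_max_left (P.nb₁ m) (max P.nb₂ (a ^ (P.ρ₂ / P.γ₁)))]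
  · linarith [le_max_right (P.nb₁ m) (max P.nb₂ (a ^ (P.ρ₂ / P.γ₁))),
      le_max_left P.nb₂ (a ^ (P.ρ₂ / P.γ₁))]
  · linarith [le_max_right (P.nb₁ m) (max P.nb₂ (a ^ (P.ρ₂ / P.γ₁))),
      le_max_right P.nb₂ (a ^ (P.ρ₂ / P.γ₁))]

end PTSParams.Admissible

/-! ### Composition along Laplace noise, and measurability of the stages -/

/-- Adaptive composition. The error `g` of the continuation may depend on the released value, and
only its mean under the noise for `a` counts, so bad released values are charged by their
probability. Scale zero must be allowed because the slope bound can vanish; then `h` forces `a =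
a'`. -/
theorem lintegral_laplace_le {b c d a a' : ℝ} (hb : 0 ≤ b) (hd : 0 ≤ d) (h : |a - a'| ≤ d * b)
    {f f' g : ℝ → ENNReal} (hf' : Measurable f') (hg : Measurable g) {e : ENNReal}
    (hge : ∫⁻ l, g (a + l) ∂laplace b ≤ e)
    (hfg : ∀ u, f u ≤ ENNReal.ofReal (Real.exp c) * f' u + g u) :
    ∫⁻ l, f (a + l) ∂laplace b
      ≤ ENNReal.ofReal (Real.exp (c + d)) * ∫⁻ l, f' (a' + l) ∂laplace b + e := by
  have hshift : ∫⁻ l, f' (a + l) ∂laplace b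
      ≤ ENNReal.ofReal (Real.exp d) * ∫⁻ l, f' (a' + l) ∂laplace b := by
    rcases hb.eq_or_lt with rfl | hb
    · have : a = a' := by
        rw [mul_zero] at h
        exact sub_eq_zero.1 (abs_nonpos_iff.1 h)
      rw [this]
      refine le_mul_of_one_le_left (by positivity) ?_
      rw [ENNReal.one_le_ofReal]
      exact Real.one_le_exp hd
    · exact lintegral_laplace_shift_le hb hf' h
  calc ∫⁻ l, f (a + l) ∂laplace b
      ≤ ∫⁻ l, (ENNReal.ofReal (Real.exp c) * f' (a + l) + g (a + l)) ∂laplace b :=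
        lintegral_mono fun l => hfg _
    _ = ENNReal.ofReal (Real.exp c) * ∫⁻ l, f' (a + l) ∂laplace b
        + ∫⁻ l, g (a + l) ∂laplace b := by
        rw [lintegral_add_right _ (by fun_prop), lintegral_const_mul _ (by fun_prop)]
    _ ≤ ENNReal.ofReal (Real.exp c) * (ENNReal.ofReal (Real.exp d)
        * ∫⁻ l, f' (a' + l) ∂laplace b) + e := by gcongr
    _ = _ := by rw [← mul_assoc, ← ENNReal.ofReal_mul (by positivity), ← Real.exp_add]

/-- The filtered database takes finitely many values as `ω` varies; the induction decides the
records one at a time. -/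
theorem measurable_filter {Ω β : Type*} [MeasurableSpace Ω] [MeasurableSpace β] (D : Database)
    (p : Ω → Record → Prop) [∀ ω, DecidablePred (p ω)] (hp : ∀ r, MeasurableSet {ω | p ω r})
    {G : Database → Ω → β} (hG : ∀ W, Measurable (G W)) :
    Measurable fun ω => G (D.filter (p ω)) ω := by
  induction D using Multiset.induction_on generalizing G with
  | empty => simpa using hG 0
  | cons r D ih =>
    have : (fun ω => G ((r ::ₘ D).filter (p ω)) ω)
        = fun ω => if p ω r then G (r ::ₘ D.filter (p ω)) ω else G (D.filter (p ω)) ω := by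
      ext ω
      split_ifs with h <;> simp [h]
    rw [this]
    exact Measurable.ite (hp r) (ih (G := fun W => G (r ::ₘ W)) fun W => hG _) (ih hG)

theorem measurable_bind_left {Ω R : Type*} [MeasurableSpace Ω] [MeasurableSpace R]
    (μ : Measure ℝ) [SFinite μ] {K : Ω × ℝ → Measure R} (hK : Measurable K) :
    Measurable fun ω => μ.bind fun l => K (ω, l) := by
  refine Measure.measurable_of_measurable_coe _ fun s hs => ?_
  have : (fun ω => (μ.bind fun l => K (ω, l)) s) = fun ω => ∫⁻ l, K (ω, l) s ∂μ := by
    ext ω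
    exact Measure.bind_apply hs (hK.comp measurable_prodMk_left).aemeasurable
  rw [this]
  exact ((Measure.measurable_coe hs).comp hK).lintegral_prod_right'

namespace PTSParams

variable {P : PTSParams}

theorem slopeBound_nonneg (n₁' : ℝ) : 0 ≤ P.slopeBound n₁' :=
  Real.rpow_nonneg (le_max_right _ _) _

theorem measurable_nMin (n₁ : ℝ) : Measurable (P.nMin n₁) := by
  unfold nMin nb₁
  fun_prop

/-- The law of the output of the last steps, given `((n₂, m̆), l)` with `l` the noise of the test. -/
noncomputable def testStage (P : PTSParams) (D : Database) (q : (ℝ × ℝ) × ℝ) :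
    Measure (Unit ⊕ ℝ) :=
  if ((P.W D q.1.1 q.1.2).card : ℝ) - P.shift + q.2 < P.nMin D.card q.1.2
  then Measure.dirac (Sum.inl ())
  else (posteriorGiven P.α P.β (P.W D q.1.1 q.1.2)).map Sum.inr

theorem testSample_eq (D : Database) (n₂ m' : ℝ) : P.testSample D n₂ m' =
    (laplace (1 / P.ε)).bind fun l => P.testStage D ((n₂, m'), l) :=
  rfl

theorem measurable_testStage (D : Database) : Measurable (P.testStage D) := by
  refine measurable_filter D (fun q : (ℝ × ℝ) × ℝ => fun r => |r.2 / r.1 - q.1.2| ≤ q.1.1 ^ P.ρ₂)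
    (fun r => measurableSet_le (by fun_prop) (by fun_prop))
    (G := fun W q => if (W.card : ℝ) - P.shift + q.2 < P.nMin D.card q.1.2
      then (Measure.dirac (Sum.inl ()) : Measure (Unit ⊕ ℝ))
      else (posteriorGiven P.α P.β W).map Sum.inr) fun W => ?_
  have := P.measurable_nMin D.card
  exact Measurable.ite (measurableSet_lt (by fun_prop) (by fun_prop)) measurable_const
    measurable_const

/-- The law of the output of the last steps, given the noisy count `n₁'` and `n₂`. -/
noncomputable def slopeStage (P : PTSParams) (D : Database) (n₁' n₂ : ℝ) : Measure (Unit ⊕ ℝ) :=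
  if n₂ ≤ 1 then Measure.dirac (Sum.inl ())
  else (laplace (P.slopeScale n₁' n₂)).bind fun l₃ =>
    P.testSample D n₂ (slope (P.V D n₁') + l₃)

/-- The law of the output of the last steps, given the noisy count `n₁'`. -/
noncomputable def countStage (P : PTSParams) (D : Database) (n₁' : ℝ) : Measure (Unit ⊕ ℝ) :=
  (laplace (1 / P.ε)).bind fun l₂ => P.slopeStage D n₁' ((P.V D n₁').card - P.shift + l₂)

theorem proposeTestSampleClipped_eq (D : Database) : P.proposeTestSampleClipped D =
    (laplace (1 / P.ε)).bind fun l₁ => P.countStage D (D.card - P.shift + l₁) :=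
  rfl

theorem measurableSet_slopeBound (r : Record) :
    MeasurableSet {n₁' : ℝ | r.2 / r.1 ≤ P.slopeBound n₁'} := by
  unfold slopeBound
  exact measurableSet_le (by fun_prop) (by fun_prop)

namespace Admissible

variable (hP : P.Admissible)
include hP

theorem isProbabilityMeasure_posteriorGiven (W : Database) :
    IsProbabilityMeasure (posteriorGiven P.α P.β W) := by
  rw [posteriorGiven_eq_gaussianReal hP.hα hP.β_pos]
  infer_instance

theorem isProbabilityMeasure_noise : IsProbabilityMeasure (laplace (1 / P.ε)) :=
  isProbabilityMeasure_laplace (one_div_pos.2 hP.hε).le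

theorem slopeScale_nonneg (n₁' : ℝ) {n₂ : ℝ} (hn : 1 < n₂) : 0 ≤ P.slopeScale n₁' n₂ := by
  have h1 := hP.hε
  have h2 := hP.hxl
  have h3 := hP.xh_pos
  have h4 := P.slopeBound_nonneg n₁'
  have h5 : 0 < n₂ - 1 := by linarith
  have h6 : 0 < n₂ := by linarith
  unfold slopeScale
  positivity

theorem measurable_testSample (D : Database) :
    Measurable fun q : ℝ × ℝ => P.testSample D q.1 q.2 := by
  have := hP.isProbabilityMeasure_noise
  simp only [testSample_eq]
  exact measurable_bind_left (laplace (1 / P.ε)) (P.measurable_testStage D)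

theorem isProbabilityMeasure_testSample (D : Database) (n₂ m' : ℝ) :
    IsProbabilityMeasure (P.testSample D n₂ m') := by
  have := hP.isProbabilityMeasure_noise
  have hm := P.measurable_testStage D
  rw [testSample_eq]
  refine isProbabilityMeasure_bind (by fun_prop) (Filter.Eventually.of_forall fun l => ?_)
  unfold testStage
  split_ifs
  · infer_instance
  · have := hP.isProbabilityMeasure_posteriorGiven (P.W D n₂ m')
    exact Measure.isProbabilityMeasure_map measurable_inr.aemeasurable

/-- The noise scale varies with the parameters, so the noise is rewritten as a multiple of `laplace
1`. This is valid where `n₂ > 1`, which makes the scale nonnegative. -/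
theorem measurable_slopeStage (D : Database) :
    Measurable fun q : ℝ × ℝ => P.slopeStage D q.1 q.2 := by
  have : (fun q : ℝ × ℝ => P.slopeStage D q.1 q.2) = fun q : ℝ × ℝ =>
      if q.2 ≤ 1 then Measure.dirac (Sum.inl ()) else (laplace 1).bind fun z =>
        P.testSample D q.2 (slope (P.V D q.1) + P.slopeScale q.1 q.2 * z) := by
    ext1 q
    unfold slopeStage
    split_ifs with h
    · rfl
    · have := hP.measurable_testSample D
      rw [laplace_eq_map (hP.slopeScale_nonneg q.1 (not_le.1 h)), Measure.bind, Measure.bind,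
        Measure.map_map (by fun_prop) (by fun_prop)]
      rfl
  rw [this]
  refine Measurable.ite (measurableSet_le (by fun_prop) (by fun_prop)) measurable_const ?_
  refine measurable_bind_left (laplace 1) (K := fun w : (ℝ × ℝ) × ℝ =>
    P.testSample D w.1.2 (slope (P.V D w.1.1) + P.slopeScale w.1.1 w.1.2 * w.2)) ?_
  refine Measurable.comp (g := fun q : ℝ × ℝ => P.testSample D q.1 q.2)
    (f := fun w : (ℝ × ℝ) × ℝ =>
      (w.1.2, slope (P.V D w.1.1) + P.slopeScale w.1.1 w.1.2 * w.2))
    (hP.measurable_testSample D) (Measurable.prodMk (by fun_prop) ?_)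
  refine Measurable.add ?_ ?_
  · exact measurable_filter D (fun w : (ℝ × ℝ) × ℝ => fun r => r.2 / r.1 ≤ P.slopeBound w.1.1)
      (fun r => measurable_fst (measurable_fst (P.measurableSet_slopeBound r)))
      (G := fun V _ => slope V) fun V => measurable_const
  · unfold slopeScale slopeBound
    fun_prop

theorem isProbabilityMeasure_slopeStage (D : Database) (n₁' n₂ : ℝ) :
    IsProbabilityMeasure (P.slopeStage D n₁' n₂) := by
  unfold slopeStage
  split_ifs with h
  · infer_instance
  · have := isProbabilityMeasure_laplace (hP.slopeScale_nonneg n₁' (not_le.1 h))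
    have hm := hP.measurable_testSample D
    exact isProbabilityMeasure_bind (hm.comp (by fun_prop : Measurable fun l : ℝ =>
        (n₂, slope (P.V D n₁') + l))).aemeasurable
      (Filter.Eventually.of_forall fun l => hP.isProbabilityMeasure_testSample D _ _)

theorem measurable_countStage (D : Database) : Measurable (P.countStage D) := by
  have := hP.isProbabilityMeasure_noise
  refine measurable_bind_left (laplace (1 / P.ε)) (K := fun w : ℝ × ℝ =>
    P.slopeStage D w.1 ((P.V D w.1).card - P.shift + w.2)) ?_
  refine measurable_filter D (fun w : ℝ × ℝ => fun r => r.2 / r.1 ≤ P.slopeBound w.1)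
    (fun r => measurable_fst (P.measurableSet_slopeBound r))
    (G := fun V w => P.slopeStage D w.1 (V.card - P.shift + w.2)) fun V => ?_
  exact (hP.measurable_slopeStage D).comp
    (by fun_prop : Measurable fun w : ℝ × ℝ => (w.1, (V.card : ℝ) - P.shift + w.2))

theorem isProbabilityMeasure_countStage (D : Database) (n₁' : ℝ) :
    IsProbabilityMeasure (P.countStage D n₁') := by
  have := hP.isProbabilityMeasure_noise
  have hm := hP.measurable_slopeStage D
  exact isProbabilityMeasure_bind (hm.comp (by fun_prop : Measurable fun l : ℝ =>
      (n₁', ((P.V D n₁').card : ℝ) - P.shift + l))).aemeasurable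
    (Filter.Eventually.of_forall fun l => hP.isProbabilityMeasure_slopeStage D _ _)

theorem isProbabilityMeasure_proposeTestSampleClipped (D : Database) :
    IsProbabilityMeasure (P.proposeTestSampleClipped D) := by
  have := hP.isProbabilityMeasure_noise
  have hm := hP.measurable_countStage D
  rw [proposeTestSampleClipped_eq]
  exact isProbabilityMeasure_bind (by fun_prop)
    (Filter.Eventually.of_forall fun l => hP.isProbabilityMeasure_countStage D _)

/-! ### The shift of the noisy counts and the test statistic -/

theorem shift_nonneg : 0 ≤ P.shift := by
  have h1 := hP.hε
  have h2 := hP.hδ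
  have : 1 ≤ 1 / (2 * P.δ) := by
    rw [one_le_div (by positivity)]
    linarith [hP.hδ₁]
  exact mul_nonneg (by positivity) (Real.log_nonneg this)

/-- The tail `exp (-ε s) / 2` equals `δ` exactly at `s = shift`. -/
theorem noise_Ici_shift : laplace (1 / P.ε) (Set.Ici P.shift) = ENNReal.ofReal P.δ := by
  have h1 := hP.hε
  have h2 := hP.hδ
  rw [laplace_Ici (by positivity) hP.shift_nonneg]
  have : -P.shift / (1 / P.ε) = Real.log (2 * P.δ) := by
    rw [shift, one_div (2 * P.δ), Real.log_inv]
    field_simp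
  rw [this, Real.exp_log (by positivity)]
  congr 1
  ring

theorem abs_testStatistic_sub_le {D D' : Database} (h : ShareAllButOne D D') (n₂ m' : ℝ) :
    |((P.W D n₂ m').card - P.nMin D.card m') - ((P.W D' n₂ m').card - P.nMin D'.card m')|
      ≤ 1 := by
  have hp : 0 ≤ P.ρ₂ / P.γ₁ := div_nonneg hP.hρ₂.le (hP.hρ₂.trans hP.hγ₁).le
  have hadd : ∀ C A : Database, A.card = 1 →
      |((P.W (C + A) n₂ m').card - P.nMin (C + A).card m')
        - ((P.W C n₂ m').card - P.nMin C.card m')| ≤ 1 := by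
    intro C A hA
    have h1 : ((Multiset.filter (fun r => |r.2 / r.1 - m'| ≤ n₂ ^ P.ρ₂) A).card : ℝ) ≤ 1 := by
      exact_mod_cast (Multiset.card_le_card (Multiset.filter_le _ A)).trans hA.le
    have h2 := hP.nMin_add_one_le (Nat.cast_nonneg C.card) m'
    have h3 := nMin_mono (P := P) hp (Nat.cast_nonneg C.card)
      (le_add_of_nonneg_right zero_le_one) m'
    have h4 : (0 : ℝ) ≤ (Multiset.filter (fun r => |r.2 / r.1 - m'| ≤ n₂ ^ P.ρ₂) A).card := by
      positivity
    simp only [W, Multiset.filter_add, Multiset.card_add, hA]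
    push_cast
    rw [abs_le]
    constructor <;> linarith
  have hcard := (h.filter fun r => |r.2 / r.1 - m'| ≤ n₂ ^ P.ρ₂).abs_card_sub_le
  obtain ⟨C, A, A', rfl, rfl, hA, hA'⟩ := h
  -- For databases of equal size the thresholds agree, and only `|W|` can change.
  have hsame : A.card = A'.card →
      |((P.W (C + A) n₂ m').card - P.nMin (C + A).card m')
        - ((P.W (C + A') n₂ m').card - P.nMin (C + A').card m')| ≤ 1 := by
    intro e
    have : (C + A).card = (C + A').card := by simp [e]
    rw [this, sub_sub_sub_cancel_right]
    exact hcard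
  rcases Nat.le_one_iff_eq_zero_or_eq_one.1 hA with hA | hA <;>
    rcases Nat.le_one_iff_eq_zero_or_eq_one.1 hA' with hA' | hA'
  · exact hsame (hA.trans hA'.symm)
  · rw [Multiset.card_eq_zero.1 hA, add_zero, abs_sub_comm]
    exact hadd C A' hA'
  · rw [Multiset.card_eq_zero.1 hA', add_zero]
    exact hadd C A hA
  · exact hsame (hA.trans hA'.symm)

end Admissible

end PTSParams

/-! ### Sensitivity of the least-squares slope -/

theorem slope_mem_Icc {V : Database} {t : ℝ} (ht : 0 ≤ t)
    (hV : ∀ r ∈ V, 0 < r.1 ∧ 0 ≤ r.2 ∧ r.2 / r.1 ≤ t) :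
    0 ≤ PTSParams.slope V ∧ PTSParams.slope V ≤ t := by
  have h1 : 0 ≤ (V.map fun r => r.1 * r.2).sum := by
    refine Multiset.sum_nonneg fun x hx => ?_
    obtain ⟨r, hr, rfl⟩ := Multiset.mem_map.1 hx
    exact mul_nonneg (hV r hr).1.le (hV r hr).2.1
  have h2 : (V.map fun r => r.1 * r.2).sum ≤ t * (V.map fun r => r.1 ^ 2).sum := by
    rw [← Multiset.sum_map_mul_left]
    refine Multiset.sum_map_le_sum_map _ _ fun r hr => ?_
    obtain ⟨hx, -, h⟩ := hV r hr
    rw [div_le_iff₀ hx] at h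
    nlinarith
  exact ⟨div_nonneg h1 (sum_sq_nonneg V), div_le_of_le_mul₀ (sum_sq_nonneg V) ht h2⟩

/-- The residuals of `V` about its slope `m` sum to zero, so `(m - m') ∑_{V'} x²` involves only the
exceptional records. As `m` and all slopes lie in `[0, t]`, their residuals fill an interval of
length `xh² t`, and `V'` has at least `|V| - 1` records. -/
theorem abs_slope_sub_le {V V' : Database} {xl xh t : ℝ} (h : ShareAllButOne V V')
    (hxl : 0 < xl) (ht : 0 ≤ t) (hn : 2 ≤ V.card)
    (hV : ∀ r ∈ V, (xl ≤ r.1 ∧ r.1 ≤ xh ∧ 0 ≤ r.2) ∧ r.2 / r.1 ≤ t)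
    (hV' : ∀ r ∈ V', (xl ≤ r.1 ∧ r.1 ≤ xh ∧ 0 ≤ r.2) ∧ r.2 / r.1 ≤ t) :
    |PTSParams.slope V - PTSParams.slope V'| * ((V.card - 1) * xl ^ 2) ≤ xh ^ 2 * t := by
  have hn' : (2 : ℝ) ≤ V.card := by exact_mod_cast hn
  have hcard := (abs_le.1 h.abs_card_sub_le).2
  have hB : (V.card : ℝ) * xl ^ 2 ≤ (V.map fun r => r.1 ^ 2).sum :=
    card_mul_sq_le hxl.le fun r hr => (hV r hr).1.1
  have hB' : ((V.card : ℝ) - 1) * xl ^ 2 ≤ (V'.map fun r => r.1 ^ 2).sum := by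
    refine le_trans ?_ (card_mul_sq_le hxl.le fun r hr => (hV' r hr).1.1)
    gcongr
    linarith
  have hB0 : 0 < (V.map fun r => r.1 ^ 2).sum := lt_of_lt_of_le (by positivity) hB
  have hB0' : 0 < (V'.map fun r => r.1 ^ 2).sum :=
    lt_of_lt_of_le (mul_pos (by linarith) (by positivity)) hB'
  obtain ⟨hm0, hmt⟩ := slope_mem_Icc ht fun r hr =>
    ⟨hxl.trans_le (hV r hr).1.1, (hV r hr).1.2.2, (hV r hr).2⟩
  set m := PTSParams.slope V with hm
  have key : ∀ r : Record, (xl ≤ r.1 ∧ r.1 ≤ xh ∧ 0 ≤ r.2) ∧ r.2 / r.1 ≤ t →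
      xh ^ 2 * -m ≤ r.1 * r.2 - m * r.1 ^ 2 ∧ r.1 * r.2 - m * r.1 ^ 2 ≤ xh ^ 2 * (t - m) := by
    intro r hr
    have hx := hxl.trans_le hr.1.1
    have := div_nonneg hr.1.2.2 hx.le
    exact scaled_mem_Icc hx hr.1.2.1 (by linarith) (by linarith) (by linarith) (by linarith [hr.2])
  have n1 : xh ^ 2 * -m ≤ 0 := mul_nonpos_of_nonneg_of_nonpos (sq_nonneg _) (by linarith)
  have n2 : 0 ≤ xh ^ 2 * (t - m) := mul_nonneg (sq_nonneg _) (by linarith)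
  have e1 : m * (V.map fun r => r.1 ^ 2).sum = (V.map fun r => r.1 * r.2).sum := by
    rw [hm, PTSParams.slope, div_mul_cancel₀ _ hB0.ne']
  have e2 : PTSParams.slope V' * (V'.map fun r => r.1 ^ 2).sum
      = (V'.map fun r => r.1 * r.2).sum := by
    rw [PTSParams.slope, div_mul_cancel₀ _ hB0'.ne']
  have e3 : |m - PTSParams.slope V'| * (V'.map fun r => r.1 ^ 2).sum ≤ xh ^ 2 * t := by
    obtain ⟨C, A, A', rfl, rfl, hA, hA'⟩ := h
    obtain ⟨h1, h2⟩ := sum_map_mem_Icc hA n1 n2 fun r hr => key r (hV r (by simp [hr]))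
    obtain ⟨h3, h4⟩ := sum_map_mem_Icc hA' n1 n2 fun r hr => key r (hV' r (by simp [hr]))
    rw [← abs_of_pos hB0', ← abs_mul]
    have e : (m - PTSParams.slope (C + A')) * ((C + A').map fun r => r.1 ^ 2).sum
        = (A.map fun r => r.1 * r.2 - m * r.1 ^ 2).sum
          - (A'.map fun r => r.1 * r.2 - m * r.1 ^ 2).sum := by
      rw [sub_mul, e2, sum_mul_sub, sum_mul_sub]
      simp only [Multiset.map_add, Multiset.sum_add] at e1 ⊢
      linear_combination e1
    rw [e, abs_le]
    constructor <;> linarith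
  exact (mul_le_mul_of_nonneg_left hB' (abs_nonneg _)).trans e3

namespace PTSParams.Admissible

variable {P : PTSParams} (hP : P.Admissible)
include hP

theorem abs_slope_sub_le_slopeScale {D D' : Database} (h : ShareAllButOne D D')
    (hD : ∀ r ∈ D, P.IsClipped r) (hD' : ∀ r ∈ D', P.IsClipped r) {n₁' n₂ : ℝ} (hn : 1 < n₂)
    (hnV : n₂ ≤ (P.V D n₁').card) :
    |slope (P.V D n₁') - slope (P.V D' n₁')| ≤ P.ε * P.slopeScale n₁' n₂ := by
  have hε := hP.hε
  have hxl := hP.hxl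
  have hxh := hP.xh_pos
  have ht := P.slopeBound_nonneg n₁'
  have h2 : 2 ≤ (P.V D n₁').card := by
    have : (1 : ℝ) < (P.V D n₁').card := by linarith
    exact_mod_cast this
  have hsl := abs_slope_sub_le (h.filter fun r => r.2 / r.1 ≤ P.slopeBound n₁') hxl ht h2
    (fun r hr => ⟨hD r (Multiset.mem_filter.1 hr).1, (Multiset.mem_filter.1 hr).2⟩)
    (fun r hr => ⟨hD' r (Multiset.mem_filter.1 hr).1, (Multiset.mem_filter.1 hr).2⟩)
  change |slope (P.V D n₁') - slope (P.V D' n₁')| * (((P.V D n₁').card - 1) * P.xl ^ 2) ≤ _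
    at hsl
  have h2' : (2 : ℝ) ≤ (P.V D n₁').card := by exact_mod_cast h2
  set n : ℝ := ((P.V D n₁').card : ℝ) with hn_def
  set t := P.slopeBound n₁'
  have p1 : 0 < n - 1 := by linarith
  have p2 : 0 < n₂ - 1 := by linarith
  have p3 : 0 < n₂ := by linarith
  calc |slope (P.V D n₁') - slope (P.V D' n₁')| ≤ P.xh ^ 2 * t / ((n - 1) * P.xl ^ 2) :=
        (le_div_iff₀ (by positivity)).2 hsl
    -- `|V| ≥ 2` gives `|V| - 1 ≥ |V| / 2 ≥ n₂ / 2`; the term `xh⁴` of the scale is not needed.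
    _ ≤ P.xh ^ 2 * t / (n₂ / 2 * P.xl ^ 2) := by gcongr; linarith
    _ = t * ((2 * (n₂ - 1) * P.xh ^ 2 * P.xl ^ 2) / (n₂ * (n₂ - 1) * P.xl ^ 4)) := by
        field_simp
    _ ≤ t * ((2 * (n₂ - 1) * P.xh ^ 2 * P.xl ^ 2 + P.xh ^ 4) / (n₂ * (n₂ - 1) * P.xl ^ 4)) := by
        gcongr
        exact le_add_of_nonneg_right (by positivity)
    _ = P.ε * P.slopeScale n₁' n₂ := by
        unfold slopeScale
        field_simp
        rfl

/-! ### Privacy of the stages, from the last to the first -/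

/-- If the test passes on a large enough database, the threshold `n₂ ^ ρ₂` on the residuals is
at most `|W| ^ γ₁`. -/
theorem residual_bound_le {n₁ n₂ m' w : ℝ} (hn : 0 ≤ n₂) (hn₁ : n₂ ≤ n₁)
    (hw : P.nMin n₁ m' ≤ w) : n₂ ^ P.ρ₂ ≤ w ^ P.γ₁ := by
  have hγ : 0 < P.γ₁ := hP.hρ₂.trans hP.hγ₁
  have h0 : 0 ≤ n₁ := hn.trans hn₁
  obtain ⟨-, -, -, -, -, h⟩ := hP.of_nMin_le hw
  calc n₂ ^ P.ρ₂ ≤ n₁ ^ P.ρ₂ := Real.rpow_le_rpow hn hn₁ hP.hρ₂.le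
    _ = (n₁ ^ (P.ρ₂ / P.γ₁)) ^ P.γ₁ := by rw [← Real.rpow_mul h0, div_mul_cancel₀ _ hγ.ne']
    _ ≤ w ^ P.γ₁ := Real.rpow_le_rpow (Real.rpow_nonneg h0 _) h hγ.le

/-- The test compares `|W| - n_min`, shifted and noised, with `0`. The size condition is imposed on
`D` alone: whether `|W|` reaches `n_min` decides which of the two errors is charged. -/
theorem testSample_le {D D' : Database} (h : ShareAllButOne D D')
    (hD : ∀ r ∈ D, P.IsClipped r) (hD' : ∀ r ∈ D', P.IsClipped r) {n₂ : ℝ} (hn : 0 ≤ n₂)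
    (hnD : n₂ ≤ D.card) (m' : ℝ) {S : Set (Unit ⊕ ℝ)} (hS : MeasurableSet S) :
    P.testSample D n₂ m' S
      ≤ ENNReal.ofReal (Real.exp (2 * P.ε)) * P.testSample D' n₂ m' S + ENNReal.ofReal P.δ := by
  have hε := hP.hε
  have := hP.isProbabilityMeasure_noise
  set g : Database → ℝ → ENNReal := fun X u =>
    if u < 0 then (Measure.dirac (Sum.inl ()) : Measure (Unit ⊕ ℝ)) S
    else (posteriorGiven P.α P.β (P.W X n₂ m')).map Sum.inr S with hg
  have hgm : ∀ X, Measurable (g X) := fun X =>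
    Measurable.ite measurableSet_Iio measurable_const measurable_const
  set a : Database → ℝ := fun X => ((P.W X n₂ m').card - P.nMin X.card m') - P.shift with ha
  have key : ∀ X, P.testSample X n₂ m' S = ∫⁻ l, g X (a X + l) ∂laplace (1 / P.ε) := by
    intro X
    have hm := P.measurable_testStage X
    rw [testSample_eq, Measure.bind_apply hS (by fun_prop)]
    refine lintegral_congr fun l => ?_
    have : ((P.W X n₂ m').card : ℝ) - P.shift + l < P.nMin X.card m' ↔ a X + l < 0 := by
      rw [ha]
      constructor <;> intro h <;> linarith
    simp only [testStage, hg, this]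
    split_ifs <;> rfl
  have hsens : |a D - a D'| ≤ P.ε * (1 / P.ε) := by
    rw [mul_one_div_cancel hε.ne']
    have := hP.abs_testStatistic_sub_le h n₂ m'
    simp only [ha]
    rwa [sub_sub_sub_cancel_right]
  have hpost : ∀ X, IsProbabilityMeasure ((posteriorGiven P.α P.β (P.W X n₂ m')).map
      (Sum.inr : ℝ → Unit ⊕ ℝ)) := fun X => by
    have := hP.isProbabilityMeasure_posteriorGiven (P.W X n₂ m')
    exact Measure.isProbabilityMeasure_map measurable_inr.aemeasurable
  rw [key, key]
  rcases lt_or_ge ((P.W D n₂ m').card : ℝ) (P.nMin D.card m') with hlt | hge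
  -- `W` is too small: a nonnegative statistic needs noise of at least `shift`, and a negative one
  -- gives null on both sides, so the continuation costs no `ε`.
  · have h1 : ∫⁻ l, (Set.Ici (0 : ℝ)).indicator 1 (a D + l) ∂laplace (1 / P.ε)
        ≤ ENNReal.ofReal P.δ := by
      have e : ∀ l, (Set.Ici (0 : ℝ)).indicator (1 : ℝ → ENNReal) (a D + l)
          = (Set.Ici (-a D)).indicator 1 l := by
        intro l
        simp only [Set.indicator, Set.mem_Ici, Pi.one_apply, neg_le_iff_add_nonneg']
      simp only [e]
      rw [lintegral_indicator_one measurableSet_Ici, ← hP.noise_Ici_shift]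
      refine measure_mono (Set.Ici_subset_Ici.2 ?_)
      simp only [ha]
      linarith
    refine (lintegral_laplace_le (c := 0) (one_div_pos.2 hε).le hε.le hsens (hgm D')
      (measurable_one.indicator measurableSet_Ici) h1 fun u => ?_).trans ?_
    · rw [Real.exp_zero, ENNReal.ofReal_one, one_mul]
      by_cases hu : u < 0
      · simp [hg, hu]
      · have hu' : u ∈ Set.Ici (0 : ℝ) := not_lt.1 hu
        have := hpost D
        rw [Set.indicator_of_mem hu']
        simp only [hg, if_neg hu]
        exact prob_le_one.trans le_add_self
    · gcongr
      linarith
  · have hR := hP.residual_bound_le hn hnD hge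
    have h1 : ∫⁻ l, (fun _ => ENNReal.ofReal P.δ) (a D + l) ∂laplace (1 / P.ε)
        ≤ ENNReal.ofReal P.δ := by rw [lintegral_const, measure_univ, mul_one]
    rw [two_mul]
    refine lintegral_laplace_le (one_div_pos.2 hε).le hε.le hsens (hgm D') measurable_const h1
      fun u => ?_
    simp only [hg]
    split_ifs
    · refine le_add_right (le_mul_of_one_le_left (by positivity) ?_)
      rw [ENNReal.one_le_ofReal]
      exact Real.one_le_exp hε.le
    · rw [Measure.map_apply measurable_inr hS, Measure.map_apply measurable_inr hS]
      exact hP.posterior_le (h.filter _) (fun r hr => hD r (Multiset.mem_filter.1 hr).1)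
        (fun r hr => hD' r (Multiset.mem_filter.1 hr).1) hge (Real.rpow_nonneg hn _) hR
        (fun r hr => (Multiset.mem_filter.1 hr).2) (fun r hr => (Multiset.mem_filter.1 hr).2) _

theorem slopeStage_le {D D' : Database} (h : ShareAllButOne D D')
    (hD : ∀ r ∈ D, P.IsClipped r) (hD' : ∀ r ∈ D', P.IsClipped r) {n₁' n₂ : ℝ}
    (hn : n₂ ≤ (P.V D n₁').card) {S : Set (Unit ⊕ ℝ)} (hS : MeasurableSet S) :
    P.slopeStage D n₁' n₂ S ≤ ENNReal.ofReal (Real.exp (2 * P.ε + P.ε)) * P.slopeStage D' n₁' n₂ S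
      + ENNReal.ofReal P.δ := by
  have hε := hP.hε
  unfold slopeStage
  split_ifs with h1
  · refine le_add_right (le_mul_of_one_le_left (by positivity) ?_)
    rw [ENNReal.one_le_ofReal]
    exact Real.one_le_exp (by positivity)
  · have hn1 := not_le.1 h1
    have hscale := hP.slopeScale_nonneg n₁' hn1
    have := isProbabilityMeasure_laplace hscale
    have hcard : (P.V D n₁').card ≤ D.card := Multiset.card_le_card (Multiset.filter_le _ _)
    have hm : ∀ X, Measurable (P.testSample X n₂) := fun X =>
      Measurable.comp (g := fun q : ℝ × ℝ => P.testSample X q.1 q.2) (f := fun u => (n₂, u))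
        (hP.measurable_testSample X) measurable_prodMk_left
    have hmS : ∀ X, Measurable fun u => P.testSample X n₂ u S := fun X =>
      (Measure.measurable_coe hS).comp (hm X)
    have hae : ∀ X c, Measurable fun l => P.testSample X n₂ (c + l) := fun X c =>
      (hm X).comp (measurable_const_add c)
    rw [Measure.bind_apply hS (hae _ _).aemeasurable, Measure.bind_apply hS (hae _ _).aemeasurable]
    have h1 : ∫⁻ l, (fun _ => ENNReal.ofReal P.δ) (slope (P.V D n₁') + l)
        ∂laplace (P.slopeScale n₁' n₂) ≤ ENNReal.ofReal P.δ := by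
      rw [lintegral_const, measure_univ, mul_one]
    exact lintegral_laplace_le hscale hε.le
      (hP.abs_slope_sub_le_slopeScale h hD hD' hn1 hn) (hmS D') measurable_const h1
      fun u => hP.testSample_le h hD hD' (by linarith)
        (hn.trans (by exact_mod_cast hcard)) u hS

theorem countStage_le {D D' : Database} (h : ShareAllButOne D D')
    (hD : ∀ r ∈ D, P.IsClipped r) (hD' : ∀ r ∈ D', P.IsClipped r) (n₁' : ℝ)
    {S : Set (Unit ⊕ ℝ)} (hS : MeasurableSet S) :
    P.countStage D n₁' S ≤ ENNReal.ofReal (Real.exp (2 * P.ε + P.ε + P.ε)) * P.countStage D' n₁' S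
      + ENNReal.ofReal (2 * P.δ) := by
  have hε := hP.hε
  have := hP.isProbabilityMeasure_noise
  have hm : ∀ X, Measurable (P.slopeStage X n₁') := fun X =>
    (hP.measurable_slopeStage X).comp measurable_prodMk_left
  have hmS : ∀ X, Measurable fun u => P.slopeStage X n₁' u S := fun X =>
    (Measure.measurable_coe hS).comp (hm X)
  have hae : ∀ X c, Measurable fun l => P.slopeStage X n₁' (c + l) := fun X c =>
    (hm X).comp (measurable_const_add c)
  unfold countStage
  rw [Measure.bind_apply hS (hae _ _).aemeasurable, Measure.bind_apply hS (hae _ _).aemeasurable]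
  set v : ℝ := ((P.V D n₁').card : ℝ) with hv
  -- The error at the released value `u` is `δ` from the later stages, plus `1` where `u ≥ |V|`,
  -- since nothing is known there. The latter event requires noise of at least `shift`.
  have hg : Measurable fun u : ℝ => ENNReal.ofReal P.δ + (Set.Ici v).indicator 1 u :=
    Measurable.add (f := fun _ => ENNReal.ofReal P.δ) measurable_const
      (measurable_one.indicator measurableSet_Ici)
  have h1 : ∫⁻ l, (fun u : ℝ => ENNReal.ofReal P.δ + (Set.Ici v).indicator 1 u)
      (v - P.shift + l) ∂laplace (1 / P.ε) ≤ ENNReal.ofReal (2 * P.δ) := by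
    have e : ∀ l, (Set.Ici v).indicator (1 : ℝ → ENNReal) (v - P.shift + l)
        = (Set.Ici P.shift).indicator 1 l := by
      intro l
      have : v ≤ v - P.shift + l ↔ P.shift ≤ l := by constructor <;> intro h <;> linarith
      simp only [Set.indicator, Set.mem_Ici, this, Pi.one_apply]
    simp only [e]
    rw [lintegral_add_left measurable_const, lintegral_indicator_one measurableSet_Ici,
      hP.noise_Ici_shift, lintegral_const, measure_univ, mul_one,
      ← ENNReal.ofReal_add hP.hδ.le hP.hδ.le, two_mul]
  refine lintegral_laplace_le (f := fun u => P.slopeStage D n₁' u S) (c := 2 * P.ε + P.ε)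
    (one_div_pos.2 hε).le hε.le ?_ (hmS D') hg h1 fun u => ?_
  · rw [mul_one_div_cancel hε.ne', sub_sub_sub_cancel_right]
    exact (h.filter _).abs_card_sub_le
  · rcases lt_or_ge u v with hu | hu
    · exact (hP.slopeStage_le h hD hD' hu.le hS).trans
        (add_le_add_right le_self_add _)
    · have := hP.isProbabilityMeasure_slopeStage D n₁' u
      rw [Set.indicator_of_mem (Set.mem_Ici.2 hu)]
      exact prob_le_one.trans (le_add_left le_add_self)

theorem proposeTestSampleClipped_le {D D' : Database} (h : ShareAllButOne D D')
    (hD : ∀ r ∈ D, P.IsClipped r) (hD' : ∀ r ∈ D', P.IsClipped r)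
    {S : Set (Unit ⊕ ℝ)} (hS : MeasurableSet S) :
    P.proposeTestSampleClipped D S
      ≤ ENNReal.ofReal (Real.exp (5 * P.ε)) * P.proposeTestSampleClipped D' S
        + ENNReal.ofReal (2 * P.δ) := by
  have hε := hP.hε
  have := hP.isProbabilityMeasure_noise
  have hm := hP.measurable_countStage
  have hmS : ∀ X, Measurable fun u => P.countStage X u S := fun X =>
    (Measure.measurable_coe hS).comp (hm X)
  have hae : ∀ X c, Measurable fun l => P.countStage X (c + l) := fun X c =>
    (hm X).comp (measurable_const_add c)
  rw [proposeTestSampleClipped_eq, proposeTestSampleClipped_eq,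
    Measure.bind_apply hS (hae _ _).aemeasurable, Measure.bind_apply hS (hae _ _).aemeasurable,
    show 5 * P.ε = 2 * P.ε + P.ε + P.ε + P.ε by ring]
  have h1 : ∫⁻ l, (fun _ => ENNReal.ofReal (2 * P.δ)) ((D.card : ℝ) - P.shift + l)
      ∂laplace (1 / P.ε) ≤ ENNReal.ofReal (2 * P.δ) := by
    rw [lintegral_const, measure_univ, mul_one]
  refine lintegral_laplace_le (one_div_pos.2 hε).le hε.le ?_ (hmS D') measurable_const h1
    fun u => hP.countStage_le h hD hD' u hS
  rw [mul_one_div_cancel hε.ne', sub_sub_sub_cancel_right]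
  exact h.abs_card_sub_le

theorem isClipped_of_mem_map_clip {D : Database} : ∀ r ∈ D.map P.clip, P.IsClipped r := by
  intro r hr
  obtain ⟨s, -, rfl⟩ := Multiset.mem_map.1 hr
  exact ⟨le_min (le_max_right _ _) hP.hxh.le, min_le_right _ _, le_max_right _ _⟩

end PTSParams.Admissible

theorem mainTheorem3 (P : PTSParams)
    (hε : 0 < P.ε) (hε₁ : P.ε ≤ 1) (hδ : 0 < P.δ) (hδ₁ : P.δ < 1 / 2)
    (hxl : 0 < P.xl) (hxh : P.xl < P.xh) (hα : 0 < P.α) (hβ : 3 / P.xh ^ 2 ≤ P.β)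
    (hρ₁ : 1 < P.ρ₁) (hρ₁' : P.ρ₁ < 3 / 2) (hρ₂ : 0 < P.ρ₂) (hρ₂' : P.ρ₂ < 1 / 2)
    (hγ₁ : P.ρ₂ < P.γ₁) (hγ₁' : P.γ₁ < 1 / 2) :
    IsDifferentiallyPrivate Neighbors P.proposeTestSample (5 * P.ε) (2 * P.δ) := by
  have hP : P.Admissible := ⟨hε, hε₁, hδ, hδ₁, hxl, hxh, hα, hβ, hρ₂, hγ₁, hγ₁'⟩
  exact ⟨fun D => hP.isProbabilityMeasure_proposeTestSampleClipped _, fun D D' h S hS =>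
    hP.proposeTestSampleClipped_le (h.shareAllButOne.map P.clip) hP.isClipped_of_mem_map_clip
      hP.isClipped_of_mem_map_clip hS⟩
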